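/- Let $n\ge 3$ and let $X$ be a germ at $0\in\mathbb{C}^n$ of holomorphic vector field with Taylor series $X=\sum_{j\ge k}X_j$, where $X_j$ is homogeneous of degree $j$ and $X_k\neq 0$. Assume that (a) $k\ge 2$ and $X_k$ has an isolated singularity at $0\in\mathbb{C}^n$; (b) the foliation $\mathcal{F}_{X_k}$ induced by $X_k$ on $\mathbb{P}^{n-1}$ has no algebraic invariant set of dimension $\ell$ with $0<\ell<n-1$. Here an algebraic set $V\subset\mathbb{P}^{n-1}$ is called invariant if $X_k$ is tangent to the cone over $V$, that is, if for every homogeneous polynomial $f$ vanishing on this cone the derivative $X_k(f)$ vanishes on it as well (in particular, algebraic sets consisting of singular points of the foliation are invariant). Then the centralizer $C(X)$, i.e. the set of germs at $0\in\mathbb{C}^n$ of holomorphic vector fields $Y$ with $[X,Y]=0$, is trivial: $C(X)=\mathbb{C}\cdot X=\{\lambda X : \lambda\in\mathbb{C}\}$. -/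

import Mathlib

open Filter Topology

noncomputable section

/-- Complex affine space `ℂⁿ`. -/
abbrev Cn (n : ℕ) : Type := Fin n → ℂ

/-- The complex vector space of germs at `0 ∈ ℂⁿ` of holomorphic vector fields, a vector field
being identified with the `ℂⁿ`-valued function of its components. -/
def VectorFieldGerm (n : ℕ) : Submodule ℂ (Germ (𝓝 (0 : Cn n)) (Cn n)) where
  carrier := {g | ∃ f : Cn n → Cn n, AnalyticAt ℂ f 0 ∧ (f : Germ (𝓝 (0 : Cn n)) (Cn n)) = g}
  add_mem' := by
    rintro _ _ ⟨f, hf, rfl⟩ ⟨g, hg, rfl⟩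
    exact ⟨f + g, hf.add hg, rfl⟩
  zero_mem' := ⟨0, analyticAt_const, rfl⟩
  smul_mem' := by
    rintro c _ ⟨f, hf, rfl⟩
    exact ⟨c • f, analyticAt_const.smul hf, rfl⟩

namespace VectorFieldGerm

variable {n : ℕ}

/-- The germ at `0` of the Lie bracket of two vector fields. -/
def bracketGerm (X Y : Germ (𝓝 (0 : Cn n)) (Cn n)) : Germ (𝓝 (0 : Cn n)) (Cn n) :=
  Quotient.liftOn₂ X Y
    (fun f g => ((VectorField.lieBracket ℂ f g : Cn n → Cn n) : Germ (𝓝 (0 : Cn n)) (Cn n)))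
    (fun _ _ _ _ h₁ h₂ => Germ.coe_eq.mpr
      (Filter.EventuallyEq.lieBracket_vectorField (𝕜 := ℂ) h₁ h₂))

/-- The centralizer `C(X)`: the germs of holomorphic vector fields `Y` with `[X, Y] = 0`. -/
def centralizer (X : VectorFieldGerm n) : Set (VectorFieldGerm n) :=
  {Y | bracketGerm (X : Germ (𝓝 (0 : Cn n)) (Cn n)) Y = 0}

/-- The homogeneous component `X_j` of degree `j` of the Taylor series of `X` at `0`:
`X_j(z) = (1 / j!) DʲX(0)(z, …, z)`. -/
def homogeneousPart (X : VectorFieldGerm n) (j : ℕ) : Cn n → Cn n :=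
  Quotient.liftOn (X : Germ (𝓝 (0 : Cn n)) (Cn n))
    (fun f z => ((j.factorial : ℂ)⁻¹) • iteratedFDeriv ℂ j f 0 (fun _ => z))
    (fun f g (h : f =ᶠ[𝓝 (0 : Cn n)] g) => by
      funext z
      rw [(h.iteratedFDeriv ℂ j).eq_of_nhds])

end VectorFieldGerm

/-- `0` is an isolated singularity (isolated zero) of the vector field `Z`. -/
def HasIsolatedSingularity {n : ℕ} (Z : Cn n → Cn n) : Prop :=
  Z 0 = 0 ∧ ∀ᶠ z in 𝓝[≠] (0 : Cn n), Z z ≠ 0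

/-- The complex projective space `ℙⁿ⁻¹` of lines through the origin of `ℂⁿ`. -/
abbrev ProjSpace (n : ℕ) : Type := Projectivization ℂ (Cn n)

namespace ProjSpace

variable {n : ℕ}

/-- The set of common zeros in `ℙⁿ⁻¹` of a set of homogeneous polynomials. -/
def IsAlgebraic (V : Set (ProjSpace n)) : Prop :=
  ∃ S : Set (MvPolynomial (Fin n) ℂ), (∀ f ∈ S, ∃ d : ℕ, f.IsHomogeneous d) ∧
    ∀ (z : Cn n) (hz : z ≠ 0),
      Projectivization.mk ℂ z hz ∈ V ↔ ∀ f ∈ S, MvPolynomial.eval z f = 0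

/-- An irreducible algebraic set: nonempty, and not covered by two algebraic sets unless it is
contained in one of them. -/
def IsIrredAlgebraic (V : Set (ProjSpace n)) : Prop :=
  IsAlgebraic V ∧ V.Nonempty ∧
    ∀ A B : Set (ProjSpace n), IsAlgebraic A → IsAlgebraic B → V ⊆ A ∪ B → V ⊆ A ∨ V ⊆ B

/-- The dimension of an algebraic set `V`: the supremum of the lengths `ℓ` of chains
`W₀ ⊊ W₁ ⊊ ⋯ ⊊ W_ℓ` of irreducible algebraic subsets of `V` (and `⊥` if `V` is empty). -/
def dim (V : Set (ProjSpace n)) : WithBot ℕ∞ :=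
  Order.krullDim {W : Set (ProjSpace n) // IsIrredAlgebraic W ∧ W ⊆ V}

/-- The polynomial `f` vanishes on `V`, that is, on the cone over `V`. -/
def VanishesOn (f : MvPolynomial (Fin n) ℂ) (V : Set (ProjSpace n)) : Prop :=
  ∀ (z : Cn n) (hz : z ≠ 0), Projectivization.mk ℂ z hz ∈ V → MvPolynomial.eval z f = 0

/-- `V` is invariant by the foliation of `ℙⁿ⁻¹` induced by the homogeneous vector field `Z` of
`ℂⁿ`. The direction of that foliation at `[z]` is the image of `Z(z)` under the derivative of
`ℂⁿ \ {0} → ℙⁿ⁻¹`, whose kernel `ℂ z` is tangent to the cone over `V`; so invariance says that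
`Z` is tangent to this cone: `Z(f) = ∑ᵢ Zᵢ ∂f/∂zᵢ` vanishes on `V` whenever the homogeneous
polynomial `f` vanishes on `V`. -/
def IsInvariant (Z : Cn n → Cn n) (V : Set (ProjSpace n)) : Prop :=
  ∀ (d : ℕ) (f : MvPolynomial (Fin n) ℂ), f.IsHomogeneous d → VanishesOn f V →
    ∀ (z : Cn n) (hz : z ≠ 0), Projectivization.mk ℂ z hz ∈ V →
      ∑ i, Z z i * MvPolynomial.eval z (MvPolynomial.pderiv i f) = 0

end ProjSpace

end

open MvPolynomial Asymptotics VectorField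

/-! Write `P` for the leading part of `X`, of degree `k`, and `Q` for that of some nonzero `Y` in
the centralizer, of degree `m`. Comparing lowest-order terms in `[X, Y] = 0` gives `[P, Q] = 0`. If
`Q` is always a constant multiple of `P`, then `m = k`, and a suitable `Y - c X`, which still
commutes with `X`, has no term of degree at most `k`; were it nonzero, its order would again have to
be `k`. So `Y = c X`.

For `m = 0`, Euler's identity shows that `P` vanishes along the direction of the constant field `Q`,
against the isolated singularity. For `m ≥ 1`, consider the cone where `P`, `Q` and the Euler field
are linearly dependent. It is determinantal of dimension at least 2 at the origin
(`exists_lt_lt_ker_constantCoeff_minorThree`), and the ideal of its `3 × 3` minors is stable under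
`P` because `P` commutes with `Q`. Its projectivization is thus invariant of positive dimension, so
by hypothesis it is everything and the minors vanish identically (`eq_zero_of_span_invariant`).

The same principle forbids a nontrivial common factor of the `2 × 2` minors of `P` and the Euler
field `E`, so `Q = a P + b E` with polynomials `a`, `b`. Commutation then reads `P(b) = 0` and `P(a)
= (k - 1) b`. A nonconstant polynomial first integral would give an invariant hypersurface, so `b`
is constant, then zero because `P(a)` vanishes at the origin, and finally `a` is constant
(`exists_eq_C_mul`). -/

/-! ### Heights of primes and Krull's height theorem -/

theorem Ideal.exists_lt_lt_of_two_le_height {A : Type*} [CommRing A] (M : Ideal A) [M.IsPrime]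
    (h : 2 ≤ M.height) :
    ∃ q q' : Ideal A, q.IsPrime ∧ q'.IsPrime ∧ q < q' ∧ q' < M := by
  have he := PrimeSpectrum.height_eq_orderHeight (⟨M, ‹_›⟩ : PrimeSpectrum A)
  dsimp only at he
  rw [he] at h
  obtain ⟨p, hp, hl⟩ := Order.exists_series_of_le_height (n := 2) _ h
  refine ⟨(p ⟨0, by omega⟩).asIdeal, (p ⟨1, by omega⟩).asIdeal, inferInstance, inferInstance,
    ?_, ?_⟩
  · exact p.strictMono (by simp [Fin.lt_def])
  · have h2 : p ⟨1, by omega⟩ < p (Fin.last _) := p.strictMono (by simp [Fin.lt_def, hl])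
    have h3 : p (Fin.last _) = _ := hp
    rw [h3] at h2
    exact h2

/-- Krull's height theorem: passing to the quotient by `s` lowers the height of `M` by at most the
cardinality of `s`, so height at least 2 survives. Geometrically, the locus cut out by `s` has
dimension at least 2 at `M`. -/
theorem Ideal.exists_lt_lt_of_encard_add_two_le_height {A : Type*} [CommRing A]
    [IsNoetherianRing A] {M : Ideal A} [M.IsPrime] {s : Set A} (hs : s.Finite)
    (hsM : s ⊆ M) (h : s.encard + 2 ≤ M.height) :
    ∃ q q' : Ideal A, q.IsPrime ∧ q'.IsPrime ∧ s ⊆ q ∧ q < q' ∧ q' < M := by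
  have h1 := Ideal.height_le_height_add_encard_of_subset s hsM
  have hsM' : span s ≤ M := span_le.2 hsM
  have h2 : 2 ≤ (M.map (Ideal.Quotient.mk (span s))).height := by
    have h3 := h.trans h1
    rw [add_comm] at h3
    exact (ENat.add_le_add_iff_right (by simpa using hs)).1 h3
  have : (M.map (Ideal.Quotient.mk (span s))).IsPrime := isPrime_map_quotientMk_of_isPrime hsM'
  obtain ⟨q, q', hq, hq', h12, h23⟩ := Ideal.exists_lt_lt_of_two_le_height _ h2
  have hsurj : Function.Surjective (Ideal.Quotient.mk (span s)) := Ideal.Quotient.mk_surjective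
  have hmono : ∀ {a b : Ideal (A ⧸ span s)}, a < b →
      a.comap (Ideal.Quotient.mk (span s)) < b.comap (Ideal.Quotient.mk (span s)) := by
    intro a b hab
    exact (Ideal.comap_mono hab.le).lt_of_ne
      fun he => hab.ne (Ideal.comap_injective_of_surjective _ hsurj he)
  refine ⟨q.comap _, q'.comap _, inferInstance, inferInstance, ?_, hmono h12, ?_⟩
  · intro x hx
    have : Ideal.Quotient.mk (span s) x = 0 := Ideal.Quotient.eq_zero_iff_mem.2 (subset_span hx)
    simp [this]
  · have h4 := hmono h23
    rwa [Ideal.comap_map_of_surjective _ hsurj, ← RingHom.ker_eq_comap_bot, Ideal.mk_ker,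
      sup_eq_left.2 hsM'] at h4


/-- The substitution setting the variables of index at least `j` to zero. -/
noncomputable def MvPolynomial.truncVars (j : ℕ) : MvPolynomial ℕ ℂ →ₐ[ℂ] MvPolynomial ℕ ℂ :=
  aeval fun i => if i < j then X i else 0

theorem MvPolynomial.truncVars_X (j i : ℕ) :
    truncVars j (X i) = if i < j then X i else 0 := by
  simp [truncVars]

theorem MvPolynomial.truncVars_truncVars_succ (j : ℕ) (f : MvPolynomial ℕ ℂ) :
    truncVars j (truncVars (j + 1) f) = truncVars j f := by
  rw [← AlgHom.comp_apply]
  congr 1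
  ext i : 1
  rw [AlgHom.comp_apply, truncVars_X, truncVars_X]
  split_ifs with h1 h2 h2
  · rw [truncVars_X, if_pos h2]
  · rw [truncVars_X, if_neg h2]
  · omega
  · simp

theorem MvPolynomial.truncVars_zero (f : MvPolynomial ℕ ℂ) :
    truncVars 0 f = C (constantCoeff f) := by
  have : truncVars 0 = (Algebra.ofId ℂ (MvPolynomial ℕ ℂ)).comp
      (aeval (fun _ => (0 : ℂ))) := by
    ext i : 1
    simp [truncVars_X]
  rw [this, AlgHom.comp_apply]
  simp [Algebra.ofId_apply, MvPolynomial.algebraMap_eq]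

/-- Kernels of the truncations of a homomorphism to a polynomial ring form a chain of primes. -/
theorem MvPolynomial.le_height_ker_constantCoeff_comp {A : Type*} [CommRing A]
    (φ : A →+* MvPolynomial ℕ ℂ) (N : ℕ)
    (h : ∀ j < N, ∃ e, truncVars j (φ e) = 0 ∧ truncVars (j + 1) (φ e) ≠ 0)
    (M : Ideal A) (hM : ∀ a, a ∈ M ↔ constantCoeff (φ a) = 0) [M.IsPrime] :
    (N : ℕ∞) ≤ M.height := by
  let p : ℕ → Ideal A := fun j => RingHom.ker ((truncVars j).toRingHom.comp φ)
  have hp : ∀ j, (p j).IsPrime := fun j => RingHom.ker_isPrime _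
  have hlt : ∀ j < N, p (j + 1) < p j := by
    intro j hj
    refine lt_of_le_of_ne (fun x hx => ?_) fun he => ?_
    · have hx' : truncVars (j + 1) (φ x) = 0 := hx
      change truncVars j (φ x) = 0
      rw [← truncVars_truncVars_succ, hx', map_zero]
    · obtain ⟨e, h0, h1⟩ := h j hj
      have : e ∈ p j := h0
      rw [← he] at this
      exact h1 this
  have h0 : p 0 = M := by
    ext a
    rw [hM]
    change truncVars 0 (φ a) = 0 ↔ _
    rw [truncVars_zero, map_eq_zero_iff _ (C_injective _ _)]
  have key : ∀ i ≤ N, (i : ℕ∞) ≤ (p (N - i)).height := by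
    intro i
    induction i with
    | zero => intro _; simp
    | succ i ih =>
      intro hi
      have h1 := ih (by omega)
      have h2 := hlt (N - (i + 1)) (by omega)
      rw [show N - (i + 1) + 1 = N - i by omega] at h2
      have h3 := Ideal.height_add_one_le_of_lt_of_isPrime h2
      push_cast
      exact (add_le_add_left h1 1).trans h3
  have := key N le_rfl
  rwa [Nat.sub_self, h0] at this

/-- The origin of `ℂⁿ` has height at least `n ≥ 3`, and the single equation `r = 0` costs at most
one. -/
theorem MvPolynomial.exists_lt_lt_ker_constantCoeff_of_mem {n : ℕ} (hn : 3 ≤ n)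
    {r : MvPolynomial (Fin n) ℂ} (hr : constantCoeff r = 0) :
    ∃ q q' : Ideal (MvPolynomial (Fin n) ℂ), q.IsPrime ∧ q'.IsPrime ∧ r ∈ q ∧ q < q' ∧
      q' < RingHom.ker constantCoeff := by
  have hM : (RingHom.ker (constantCoeff : MvPolynomial (Fin n) ℂ →+* ℂ)).IsPrime :=
    RingHom.ker_isPrime _
  have hh : (n : ℕ∞) ≤ (RingHom.ker (constantCoeff : MvPolynomial (Fin n) ℂ →+* ℂ)).height := by
    refine le_height_ker_constantCoeff_comp (rename (fun i : Fin n => (i : ℕ))).toRingHom n ?_ _ ?_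
    · intro j hj
      refine ⟨X ⟨j, hj⟩, ?_, ?_⟩ <;> simp [truncVars_X, X_ne_zero]
    · intro a
      simp [RingHom.mem_ker, constantCoeff_rename]
  obtain ⟨q, q', h1, h2, h3, h4, h5⟩ := Ideal.exists_lt_lt_of_encard_add_two_le_height
    (Set.finite_singleton r) (M := RingHom.ker (constantCoeff : MvPolynomial (Fin n) ℂ →+* ℂ)) (by simpa using hr) (by
      refine le_trans ?_ hh
      rw [Set.encard_singleton]
      exact_mod_cast hn)
  exact ⟨q, q', h1, h2, h3 rfl, h4, h5⟩

/-! ### The determinantal locus of two vector fields and the Euler field -/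

/-- The `3 × 3` minor in the rows `i`, `j`, `l` of the matrix with columns `x`, `y`, `z`. -/
def minorThree {ι A : Type*} [CommRing A] (x y z : ι → A) (i j l : ι) : A :=
  x i * (y j * z l - y l * z j) - y i * (x j * z l - x l * z j) + z i * (x j * y l - x l * y j)

theorem map_minorThree {ι A B F : Type*} [CommRing A] [CommRing B] [FunLike F A B]
    [RingHomClass F A B] (f : F) (x y z : ι → A) (i j l : ι) :
    f (minorThree x y z i j l) =
      minorThree (fun a => f (x a)) (fun a => f (y a)) (fun a => f (z a)) i j l := by
  simp [minorThree]

/-- The locus where two polynomial vector fields vanishing at `0` and the Euler field are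
linearly dependent has dimension at least two at `0`. -/
theorem MvPolynomial.exists_lt_lt_ker_constantCoeff_minorThree {n : ℕ} (hn : 2 ≤ n)
    (P Q : Fin n → MvPolynomial (Fin n) ℂ) (hP : ∀ i, constantCoeff (P i) = 0)
    (hQ : ∀ i, constantCoeff (Q i) = 0) :
    ∃ q q' : Ideal (MvPolynomial (Fin n) ℂ), q.IsPrime ∧ q'.IsPrime ∧
      (∀ i j l, minorThree P Q X i j l ∈ q) ∧ q < q' ∧ q' < RingHom.ker constantCoeff := by
  -- `A` is the coordinate ring of the closure of the set of triples `(ζ, β, s ζ + t β)`. This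
  -- variety is irreducible of dimension `2 n + 2`, and the locus sought is its intersection with
  -- the graph `β = P(ζ)`, `γ = Q(ζ)`, given by `2 n` equations.
  let φ : MvPolynomial (Fin n ⊕ Fin n ⊕ Fin n) ℂ →ₐ[ℂ] MvPolynomial ℕ ℂ :=
    aeval (Sum.elim (fun i => X (i : ℕ)) (Sum.elim (fun i => X (n + i))
      (fun i => X (2 * n) * X (i : ℕ) + X (2 * n + 1) * X (n + i))))
  let A := MvPolynomial (Fin n ⊕ Fin n ⊕ Fin n) ℂ ⧸ RingHom.ker φ
  let mkA : MvPolynomial (Fin n ⊕ Fin n ⊕ Fin n) ℂ →ₐ[ℂ] A := Ideal.Quotient.mkₐ ℂ _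
  let φ' : A →ₐ[ℂ] MvPolynomial ℕ ℂ := Ideal.kerLiftAlg φ
  have hφ' : Function.Injective φ' := Ideal.kerLiftAlg_injective φ
  have hmk : ∀ t, φ' (mkA t) = φ t := fun t => rfl
  let ζ : Fin n → A := fun i => mkA (X (Sum.inl i))
  let β : Fin n → A := fun i => mkA (X (Sum.inr (Sum.inl i)))
  let γ : Fin n → A := fun i => mkA (X (Sum.inr (Sum.inr i)))
  have hζ : ∀ i, φ' (ζ i) = X (i : ℕ) := fun i => by simp [ζ, hmk, φ]
  have hβ : ∀ i, φ' (β i) = X (n + i) := fun i => by simp [β, hmk, φ]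
  have hγ : ∀ i, φ' (γ i) = X (2 * n) * X (i : ℕ) + X (2 * n + 1) * X (n + i) :=
    fun i => by simp [γ, hmk, φ]
  let ι : MvPolynomial (Fin n) ℂ →ₐ[ℂ] A := aeval ζ
  have hι : ∀ i, ι (X i) = ζ i := fun i => by simp [ι]
  have hcc : ∀ r, constantCoeff (φ' (ι r)) = constantCoeff r := by
    intro r
    have : ((aeval (fun _ => (0 : ℂ))).comp (φ'.comp ι) :
        MvPolynomial (Fin n) ℂ →ₐ[ℂ] ℂ) = aeval (fun _ => (0 : ℂ)) := by
      ext i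
      simp [hι, hζ]
    have := DFunLike.congr_fun this r
    simpa using this
  let M : Ideal A := (RingHom.ker (constantCoeff : MvPolynomial ℕ ℂ →+* ℂ)).comap φ'
  have hker : (RingHom.ker (constantCoeff : MvPolynomial ℕ ℂ →+* ℂ)).IsPrime :=
    RingHom.ker_isPrime _
  have hM : M.IsPrime := Ideal.IsPrime.comap φ'
  have hmemM : ∀ a, a ∈ M ↔ constantCoeff (φ' a) = 0 := fun a => Iff.rfl
  have hheight : ((2 * n + 2 : ℕ) : ℕ∞) ≤ M.height := by
    refine le_height_ker_constantCoeff_comp φ'.toRingHom _ ?_ M hmemM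
    intro j hj
    change ∃ e, truncVars j (φ' e) = 0 ∧ truncVars (j + 1) (φ' e) ≠ 0
    by_cases h1 : j < n
    · refine ⟨ζ ⟨j, h1⟩, ?_, ?_⟩ <;> simp [hζ, truncVars_X, X_ne_zero]
    by_cases h2 : j < 2 * n
    · have h3 : n + (j - n) = j := by omega
      refine ⟨β ⟨j - n, by omega⟩, ?_, ?_⟩ <;> simp [hβ, truncVars_X, h3, X_ne_zero]
    by_cases h3 : j = 2 * n
    · subst h3
      refine ⟨γ ⟨0, by omega⟩, ?_, ?_⟩ <;> simp [hγ, truncVars_X, X_ne_zero]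
    -- The parameter `t = X (2 * n + 1)` is not itself in the image of `A`; a `2 × 2` minor of `ζ`
    -- and `γ` isolates it, since the `s ζ` part of `γ` drops out.
    · obtain rfl : j = 2 * n + 1 := by omega
      have hval : φ' (ζ ⟨0, by omega⟩ * γ ⟨1, by omega⟩ - ζ ⟨1, by omega⟩ * γ ⟨0, by omega⟩) =
          X (2 * n + 1) * (X 0 * X (n + 1) - X 1 * X n) := by
        simp only [map_sub, map_mul, hζ, hγ]
        simp only [add_zero]
        ring
      refine ⟨_, by rw [hval]; simp [truncVars_X], ?_⟩
      rw [hval]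
      simp only [map_mul, map_sub, truncVars_X]
      rw [if_pos (by omega), if_pos (by omega), if_pos (by omega), if_pos (by omega),
        if_pos (by omega)]
      refine mul_ne_zero (X_ne_zero _) fun h0 => ?_
      have := congrArg (eval fun i : ℕ => if i = 0 ∨ i = n + 1 then (1 : ℂ) else 0) h0
      simp [show n ≠ 0 by omega] at this
  let s : Set A := (Set.range fun i => β i - ι (P i)) ∪ (Set.range fun i => γ i - ι (Q i))
  have hs : s.Finite := (Set.finite_range _).union (Set.finite_range _)
  have hcard : s.encard ≤ ((2 * n : ℕ) : ℕ∞) := by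
    refine (Set.encard_union_le _ _).trans ?_
    have hr : ∀ f : Fin n → A, (Set.range f).encard ≤ (n : ℕ∞) := fun f => by
      rw [← Set.image_univ]
      exact (Set.encard_image_le _ _).trans (by simp)
    refine (add_le_add (hr _) (hr _)).trans ?_
    rw [two_mul]
    push_cast
    rfl
  have hsM : s ⊆ M := by
    rintro _ (⟨i, rfl⟩ | ⟨i, rfl⟩)
    · change _ = _
      simp [hβ, hcc, hP]
    · change _ = _
      simp [hγ, hcc, hQ]
  obtain ⟨q, q', hq, hq', hsq, h12, h23⟩ := Ideal.exists_lt_lt_of_encard_add_two_le_height hs hsM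
    (le_trans (by push_cast at hcard ⊢; gcongr) hheight)
  let θ : MvPolynomial (Fin n ⊕ Fin n ⊕ Fin n) ℂ →ₐ[ℂ] MvPolynomial (Fin n) ℂ :=
    aeval (Sum.elim X (Sum.elim P Q))
  let mkq : A →ₐ[ℂ] A ⧸ q := Ideal.Quotient.mkₐ ℂ q
  have hmkq : ∀ a, mkq a = 0 ↔ a ∈ q := fun a => Ideal.Quotient.eq_zero_iff_mem
  have hβP : ∀ i, mkq (β i) = mkq (ι (P i)) := fun i => by
    rw [← sub_eq_zero, ← map_sub, hmkq]
    exact hsq (Or.inl ⟨i, rfl⟩)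
  have hγQ : ∀ i, mkq (γ i) = mkq (ι (Q i)) := fun i => by
    rw [← sub_eq_zero, ← map_sub, hmkq]
    exact hsq (Or.inr ⟨i, rfl⟩)
  have hθ : mkq.comp (ι.comp θ) = mkq.comp mkA := by
    apply MvPolynomial.algHom_ext
    rintro (i | i | i)
    · simp [θ, hι, ζ]
    · simpa [θ] using (hβP i).symm
    · simpa [θ] using (hγQ i).symm
  -- Modulo `q` the coordinates `β` and `γ` are polynomials in `ζ`, so `ι` is surjective onto `A ⧸
  -- q`. Hence strict inclusions of ideals above `q` stay strict after pulling back along `ι`.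
  have hlift : ∀ a : A, ∃ r, a - ι r ∈ q := by
    intro a
    obtain ⟨t, rfl⟩ := Ideal.Quotient.mkₐ_surjective ℂ _ a
    refine ⟨θ t, ?_⟩
    rw [← hmkq, map_sub, sub_eq_zero]
    exact (DFunLike.congr_fun hθ t).symm
  have hmono : ∀ {a b : Ideal A}, q ≤ a → a < b → a.comap ι < b.comap ι := by
    intro a b hqa hab
    refine (Ideal.comap_mono hab.le).lt_of_not_ge fun hle => ?_
    obtain ⟨x, hxb, hxa⟩ := Set.exists_of_ssubset hab
    obtain ⟨r, hr⟩ := hlift x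
    have hrb : ι r ∈ b := by
      have := b.sub_mem hxb (hab.le (hqa hr))
      simpa using this
    have hra : ι r ∈ a := hle hrb
    exact hxa (by simpa using a.add_mem (hqa hr) hra)
  have hMc : M.comap ι = RingHom.ker constantCoeff := by
    ext r
    simp [hmemM, RingHom.mem_ker, hcc]
  refine ⟨q.comap ι, q'.comap ι, Ideal.IsPrime.comap ι, Ideal.IsPrime.comap ι, ?_,
    hmono le_rfl h12, hMc ▸ hmono h12.le h23⟩
  intro i j l
  rw [Ideal.mem_comap, ← hmkq, map_minorThree, map_minorThree]
  -- The third column is a combination of the other two by construction.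
  have hz : minorThree β γ ζ i j l = 0 := by
    apply hφ'
    rw [map_minorThree, map_zero]
    simp only [minorThree, hζ, hβ, hγ]
    ring
  have := congrArg mkq hz
  rw [map_minorThree, map_zero] at this
  simpa only [hβP, hγQ, hι] using this

/-! ### Derivations, radicals and homogeneous components -/

/-- Differentiating `f ^ (a + 1) * D f ^ (2 * j)` and multiplying by `D f` trades one factor `f` for
two factors `D f`, up to an element of `I` and the integer `a + 1`, which is invertible in
characteristic zero. Starting from `f ^ r`, this ends at `D f ^ (2 * r)`. -/
theorem Derivation.map_mem_radical {A : Type*} [CommRing A] [Algebra ℂ A] (D : Derivation ℂ A A)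
    {I : Ideal A} (hI : ∀ f ∈ I, D f ∈ I) {f : A} (hf : f ∈ I.radical) : D f ∈ I.radical := by
  obtain ⟨r, hr⟩ := hf
  have key : ∀ j a, a + j = r → f ^ a * (D f) ^ (2 * j) ∈ I := by
    intro j
    induction j with
    | zero =>
      intro a ha
      obtain rfl : a = r := ha
      simpa using hr
    | succ j ih =>
      intro a ha
      have h1 := ih (a + 1) (by omega)
      have h2 := I.mul_mem_left (D f) (hI _ h1)
      have h3 := I.mul_mem_left (((2 * j : ℕ) : A) * D (D f)) h1
      have h4 : D f * D (f ^ (a + 1) * D f ^ (2 * j)) -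
          ((2 * j : ℕ) : A) * D (D f) * (f ^ (a + 1) * D f ^ (2 * j)) =
          ((a + 1 : ℕ) : A) * (f ^ a * D f ^ (2 * (j + 1))) := by
        rw [D.leibniz, D.leibniz_pow, D.leibniz_pow]
        simp only [smul_eq_mul, nsmul_eq_mul, Nat.add_sub_cancel]
        rcases j with _ | j
        · simp; ring
        · rw [show 2 * (j + 1) - 1 = 2 * j + 1 by omega]
          ring
      have h5 : ((a + 1 : ℕ) : A) * (f ^ a * D f ^ (2 * (j + 1))) ∈ I :=
        h4 ▸ I.sub_mem h2 h3
      have h6 := I.mul_mem_left (algebraMap ℂ A ((a + 1 : ℕ) : ℂ)⁻¹) h5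
      rw [← mul_assoc, ← _root_.map_natCast (algebraMap ℂ A), ← _root_.map_mul, inv_mul_cancel₀
        (Nat.cast_ne_zero.2 (Nat.succ_ne_zero a)), _root_.map_one, one_mul] at h6
      exact h6
  refine ⟨2 * r, ?_⟩
  simpa using key r 0 (by omega)

theorem MvPolynomial.mkDerivation_eq_sum {n : ℕ} (P : Fin n → MvPolynomial (Fin n) ℂ)
    (f : MvPolynomial (Fin n) ℂ) : mkDerivation ℂ P f = ∑ i, P i * pderiv i f := by
  have hsum : ∀ g, (∑ i, P i • pderiv (R := ℂ) i) g = ∑ i, P i * pderiv i g := fun g => by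
    have := congrFun (map_sum (Derivation.coeFnAddMonoidHom (R := ℂ)
      (A := MvPolynomial (Fin n) ℂ) (M := MvPolynomial (Fin n) ℂ))
      (fun i => P i • pderiv i) Finset.univ) g
    refine Eq.trans this ?_
    rw [Finset.sum_apply]
    rfl
  have : mkDerivation ℂ P = ∑ i, P i • pderiv (R := ℂ) i := by
    apply MvPolynomial.derivation_ext
    intro i
    rw [mkDerivation_X, hsum]
    simp [pderiv_X, Pi.single_apply]
  rw [this, hsum]

theorem MvPolynomial.eval_smul_eq_sum {n : ℕ} (f : MvPolynomial (Fin n) ℂ) (t : ℂ)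
    (z : Fin n → ℂ) :
    eval (t • z) f = ∑ d ∈ Finset.range (f.totalDegree + 1),
      t ^ d * eval z (homogeneousComponent d f) := by
  have hhom : ∀ (d : ℕ) (g : MvPolynomial (Fin n) ℂ), g.IsHomogeneous d →
      eval (t • z) g = t ^ d * eval z g := by
    intro d g hg
    rw [eval_eq, eval_eq, Finset.mul_sum]
    refine Finset.sum_congr rfl fun s hs => ?_
    simp only [Pi.smul_apply, smul_eq_mul, mul_pow, Finset.prod_mul_distrib]
    rw [Finset.prod_pow_eq_pow_sum]
    rw [← hg.degree_eq_sum_deg_support hs]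
    ring
  conv_lhs => rw [← sum_homogeneousComponent f, map_sum]
  exact Finset.sum_congr rfl fun d _ => hhom d _ (homogeneousComponent_isHomogeneous d f)

theorem MvPolynomial.IsHomogeneous.eval_smul {n d : ℕ} {f : MvPolynomial (Fin n) ℂ}
    (hf : f.IsHomogeneous d) (t : ℂ) (z : Fin n → ℂ) : eval (t • z) f = t ^ d * eval z f := by
  by_cases h0 : f = 0
  · simp [h0]
  rw [eval_smul_eq_sum, hf.totalDegree h0, Finset.sum_eq_single d]
  · rw [homogeneousComponent_eq_self hf]
  · intro b _ hb
    rw [homogeneousComponent_of_mem hf, if_neg hb]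
    simp
  · simp

theorem MvPolynomial.eval_homogeneousComponent_eq_zero {n : ℕ} {f : MvPolynomial (Fin n) ℂ}
    {z : Fin n → ℂ} (h : ∀ t : ℂ, t ≠ 0 → eval (t • z) f = 0) (d : ℕ) :
    eval z (homogeneousComponent d f) = 0 := by
  by_cases hd : f.totalDegree < d
  · rw [homogeneousComponent_eq_zero _ _ hd, map_zero]
  let p : Polynomial ℂ := ∑ d ∈ Finset.range (f.totalDegree + 1),
    Polynomial.monomial d (eval z (homogeneousComponent d f))
  have hp : p = 0 := by
    refine Polynomial.eq_zero_of_infinite_isRoot p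
      ((Set.finite_singleton (0 : ℂ)).infinite_compl.mono fun t ht => ?_)
    have := h t ht
    rw [eval_smul_eq_sum] at this
    simp only [Set.mem_ofPred_eq, Polynomial.IsRoot, p, Polynomial.eval_finsetSum,
      Polynomial.eval_monomial]
    rw [← this]
    exact Finset.sum_congr rfl fun _ _ => mul_comm _ _
  have := congrArg (fun q => Polynomial.coeff q d) hp
  simpa [p, Polynomial.finsetSum_coeff, Polynomial.coeff_monomial,
    Nat.lt_succ_iff, not_lt.1 hd] using this

/-! ### Algebraic sets in projective space and their ideals -/

namespace ProjSpace

variable {n : ℕ}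

/-- The common zeros of a set of polynomials, read off on representatives. -/
def zeroSet (S : Set (MvPolynomial (Fin n) ℂ)) : Set (ProjSpace n) :=
  {p | ∀ f ∈ S, eval p.rep f = 0}

theorem mk_mem_zeroSet {S : Set (MvPolynomial (Fin n) ℂ)}
    (hS : ∀ f ∈ S, ∃ d : ℕ, f.IsHomogeneous d) {z : Cn n} (hz : z ≠ 0) :
    Projectivization.mk ℂ z hz ∈ zeroSet S ↔ ∀ f ∈ S, eval z f = 0 := by
  obtain ⟨a, ha⟩ := Projectivization.exists_smul_eq_mk_rep ℂ z hz
  refine forall₂_congr fun f hf => ?_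
  obtain ⟨d, hd⟩ := hS f hf
  have : (a : ℂ) • z = (Projectivization.mk ℂ z hz).rep := ha
  rw [← this, hd.eval_smul]
  simp

theorem isAlgebraic_zeroSet {S : Set (MvPolynomial (Fin n) ℂ)}
    (hS : ∀ f ∈ S, ∃ d : ℕ, f.IsHomogeneous d) : IsAlgebraic (zeroSet S) :=
  ⟨S, hS, fun _ hz => mk_mem_zeroSet hS hz⟩

/-- The ideal of the polynomials vanishing on the cone over `V`. -/
def coneIdeal (V : Set (ProjSpace n)) : Ideal (MvPolynomial (Fin n) ℂ) where
  carrier := {f | VanishesOn f V}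
  add_mem' hf hg z hz hV := by rw [map_add, hf z hz hV, hg z hz hV, add_zero]
  zero_mem' z hz hV := map_zero _
  smul_mem' c f hf z hz hV := by rw [smul_eq_mul, map_mul, hf z hz hV, mul_zero]

theorem mem_coneIdeal {V : Set (ProjSpace n)} {f : MvPolynomial (Fin n) ℂ} :
    f ∈ coneIdeal V ↔ ∀ (z : Cn n) (hz : z ≠ 0), Projectivization.mk ℂ z hz ∈ V → eval z f = 0 :=
  Iff.rfl

theorem mk_smul_eq {z : Cn n} (hz : z ≠ 0) {t : ℂ} (ht : t ≠ 0) :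
    Projectivization.mk ℂ (t • z) (smul_ne_zero ht hz) = Projectivization.mk ℂ z hz :=
  (Projectivization.mk_eq_mk_iff' ℂ _ _ _ _).2 ⟨t, rfl⟩

theorem homogeneousComponent_mem_coneIdeal {V : Set (ProjSpace n)} {f : MvPolynomial (Fin n) ℂ}
    (hf : f ∈ coneIdeal V) (d : ℕ) : homogeneousComponent d f ∈ coneIdeal V := by
  intro z hz hV
  refine eval_homogeneousComponent_eq_zero (fun t ht => ?_) d
  exact hf _ (smul_ne_zero ht hz) (by rwa [mk_smul_eq hz ht])

theorem coneIdeal_lt_ker_constantCoeff {V : Set (ProjSpace n)} (hV : V.Nonempty) :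
    coneIdeal V < RingHom.ker constantCoeff := by
  obtain ⟨p, hp⟩ := hV
  induction p using Projectivization.ind with | h v hv =>
  obtain ⟨i, hi⟩ := Function.ne_iff.1 hv
  refine lt_of_le_of_ne (fun f hf => ?_) fun he => ?_
  · have := homogeneousComponent_mem_coneIdeal hf 0 v hv hp
    rw [homogeneousComponent_zero, eval_C] at this
    rwa [RingHom.mem_ker, constantCoeff_eq]
  · have hX : (X i : MvPolynomial (Fin n) ℂ) ∈ coneIdeal V := by
      rw [he, RingHom.mem_ker, constantCoeff_X]
    exact hi (by simpa using hX v hv hp)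

section

attribute [local instance] MvPolynomial.gradedAlgebra

/-- The ideal is homogeneous, so primality need only be tested on homogeneous `f`, `g`; if `f * g`
vanishes on `V`, their zero sets cover `V` and irreducibility applies. -/
theorem isPrime_coneIdeal {V : Set (ProjSpace n)} (hV : IsIrredAlgebraic V) :
    (coneIdeal V).IsPrime := by
  have hhom : (coneIdeal V).IsHomogeneous (homogeneousSubmodule (Fin n) ℂ) := by
    intro d f hf
    have := homogeneousComponent_mem_coneIdeal hf d
    rwa [← decomposition.decompose'_apply] at this
  refine hhom.isPrime_of_homogeneous_mem_or_mem ?_ ?_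
  · intro htop
    have := coneIdeal_lt_ker_constantCoeff hV.2.1
    rw [htop] at this
    exact not_top_lt this
  · rintro f g ⟨d, hd⟩ ⟨e, he⟩ hfg
    have hS : ∀ {f : MvPolynomial (Fin n) ℂ} {d : ℕ},
        f ∈ homogeneousSubmodule (Fin n) ℂ d →
        ∀ h ∈ ({f} : Set (MvPolynomial (Fin n) ℂ)), ∃ d : ℕ, h.IsHomogeneous d := by
      rintro f d hd _ rfl
      exact ⟨d, hd⟩
    have hsub : ∀ {f : MvPolynomial (Fin n) ℂ} {d : ℕ},
        f ∈ homogeneousSubmodule (Fin n) ℂ d → V ⊆ zeroSet {f} → f ∈ coneIdeal V :=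
      fun hd h z hz hzV => (mk_mem_zeroSet (hS hd) hz).1 (h hzV) _ rfl
    refine (hV.2.2 (zeroSet {f}) (zeroSet {g}) (isAlgebraic_zeroSet (hS hd))
      (isAlgebraic_zeroSet (hS he)) ?_).imp (hsub hd) (hsub he)
    intro p hp
    induction p using Projectivization.ind with | h v hv =>
    have := hfg v hv hp
    rw [map_mul, mul_eq_zero] at this
    refine this.imp (fun h => ?_) (fun h => ?_)
    · rw [mk_mem_zeroSet (hS hd)]
      rintro _ rfl
      exact h
    · rw [mk_mem_zeroSet (hS he)]
      rintro _ rfl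
      exact h

/-- The homogeneous core of a prime is prime. Replacing `q` by it loses no homogeneous equation and
can only enlarge the zero locus. -/
theorem _root_.MvPolynomial.exists_isPrime_homogeneous_le {q : Ideal (MvPolynomial (Fin n) ℂ)}
    (hq : q.IsPrime) :
    ∃ J ≤ q, J.IsPrime ∧ (∀ f ∈ J, ∀ d, homogeneousComponent d f ∈ J) ∧
      ∀ f ∈ q, ∀ d, f.IsHomogeneous d → f ∈ J := by
  refine ⟨(q.homogeneousCore (homogeneousSubmodule (Fin n) ℂ)).toIdeal,
    Ideal.toIdeal_homogeneousCore_le _ _, hq.homogeneousCore, fun f hf d => ?_,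
    fun f hf d hd => Ideal.mem_homogeneousCore_of_homogeneous_of_mem ⟨d, hd⟩ hf⟩
  exact homogeneousComponent_mem_of_mem
    (q.homogeneousCore (homogeneousSubmodule (Fin n) ℂ)).isHomogeneous hf d

end

theorem coneIdeal_lt_coneIdeal {V W : Set (ProjSpace n)} (hV : IsAlgebraic V) (h : V ⊂ W) :
    coneIdeal W < coneIdeal V := by
  refine lt_of_le_not_ge (fun f hf z hz hzV => hf z hz (h.1 hzV)) fun hle => h.2 fun p hp => ?_
  obtain ⟨S, hS, hSV⟩ := hV
  induction p using Projectivization.ind with | h v hv =>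
  rw [hSV v hv]
  intro f hf
  exact hle (fun z hz hz' => (hSV z hz).1 hz' f hf) v hv hp

theorem isIrredAlgebraic_singleton (p : ProjSpace n) : IsIrredAlgebraic {p} := by
  refine ⟨?_, Set.singleton_nonempty p, fun A B _ _ h => ?_⟩
  · induction p using Projectivization.ind with | h v hv =>
    obtain ⟨i, hi⟩ := Function.ne_iff.1 hv
    refine ⟨Set.range fun j => C (v i) * X j - C (v j) * X i, ?_, fun z hz => ?_⟩
    · rintro _ ⟨j, rfl⟩
      exact ⟨1, (isHomogeneous_C_mul_X _ _).sub (isHomogeneous_C_mul_X _ _)⟩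
    · rw [Set.mem_singleton_iff, Projectivization.mk_eq_mk_iff', Set.forall_mem_range]
      constructor
      · rintro ⟨a, rfl⟩ j
        simp
        ring
      · intro h
        have hi' : v i ≠ 0 := hi
        refine ⟨z i / v i, ?_⟩
        ext j
        have := h j
        simp only [map_sub, map_mul, eval_C, eval_X] at this
        simp only [Pi.smul_apply, smul_eq_mul]
        field_simp
        linear_combination -this
  · simpa using h

/-- The dimension of a proper algebraic set is at most `n - 2`. -/
theorem dim_le {V : Set (ProjSpace n)} (hV : coneIdeal V ≠ ⊥) :
    dim V ≤ ((n - 2 : ℕ) : WithBot ℕ∞) := by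
  refine iSup_le fun p => ?_
  let F : {W : Set (ProjSpace n) // IsIrredAlgebraic W ∧ W ⊆ V} →
      (PrimeSpectrum (MvPolynomial (Fin n) ℂ))ᵒᵈ :=
    fun W => OrderDual.toDual ⟨coneIdeal W.1, isPrime_coneIdeal W.2.1⟩
  have hF : StrictMono F := fun A B hAB => coneIdeal_lt_coneIdeal A.2.1.1 hAB
  have hker : (RingHom.ker (constantCoeff : MvPolynomial (Fin n) ℂ →+* ℂ)).IsPrime :=
    RingHom.ker_isPrime _
  -- A chain of irreducible sets becomes a chain of primes, lengthened at both ends, by the zero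
  -- ideal and by the ideal of the origin. Its length is at most the Krull dimension `n`, whence the
  -- `n - 2`.
  let q := ((p.map F hF).snoc (OrderDual.toDual ⟨⊥, Ideal.isPrime_bot⟩) (by
    rw [LTSeries.last_map]
    change (⊥ : Ideal _) < coneIdeal (RelSeries.last p).1
    refine bot_lt_iff_ne_bot.2 fun h0 => hV (le_bot_iff.1 (le_trans ?_ h0.le))
    exact fun f hf z hz hzV => hf z hz ((RelSeries.last p).2.2 hzV)))
  let q' := q.cons (OrderDual.toDual ⟨_, hker⟩) (by
    change _ < RelSeries.head q
    rw [RelSeries.head_snoc, LTSeries.head_map]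
    exact coneIdeal_lt_ker_constantCoeff (RelSeries.head p).2.1.2.1)
  have h1 := Order.LTSeries.length_le_krullDim q'
  rw [Order.krullDim_orderDual] at h1
  change _ ≤ ringKrullDim _ at h1
  rw [MvPolynomial.ringKrullDim_of_isNoetherianRing, ringKrullDim_eq_zero_of_field, zero_add,
    Nat.card_eq_fintype_card, Fintype.card_fin] at h1
  have h2 : q'.length = p.length + 2 := by
    simp [q', q, RelSeries.cons, RelSeries.snoc, LTSeries.map]
  rw [h2] at h1
  have h3 : p.length + 2 ≤ n := by exact_mod_cast h1
  exact_mod_cast (by omega : p.length ≤ n - 2)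

/-- Nullstellensatz with the origin removed: `X i * f` also vanishes at `0`, hence lies in `J`, and
some variable `X i` lies outside `J` because `J` is strictly smaller than the ideal of the origin.
-/
theorem mem_of_forall_eval_eq_zero {J : Ideal (MvPolynomial (Fin n) ℂ)} [J.IsPrime]
    {f : MvPolynomial (Fin n) ℂ} (hJ : J < RingHom.ker constantCoeff)
    (h : ∀ z : Cn n, z ≠ 0 → (∀ g ∈ J, eval z g = 0) → eval z f = 0) : f ∈ J := by
  obtain ⟨i, hi⟩ : ∃ i, (X i : MvPolynomial (Fin n) ℂ) ∉ J := by
    by_contra! hX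
    refine hJ.not_ge fun g hg => ?_
    rw [RingHom.mem_ker, constantCoeff_eq] at hg
    have hspan : g ∈ Ideal.span (X '' (Set.univ : Set (Fin n)) :
        Set (MvPolynomial (Fin n) ℂ)) := by
      rw [mem_ideal_span_X_image]
      intro m hm
      by_contra! hm'
      have : m = 0 := by
        ext i
        simpa using hm' i (Set.mem_univ i)
      rw [mem_support_iff, this] at hm
      exact hm hg
    refine Ideal.span_le.2 ?_ hspan
    rintro _ ⟨i, -, rfl⟩
    exact hX i
  have hmem : X i * f ∈ J := by
    rw [← IsPrime.vanishingIdeal_zeroLocus (K := ℂ) J, mem_vanishingIdeal_iff]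
    intro z hz
    rw [map_mul, aeval_X]
    by_cases hz0 : z = 0
    · simp [hz0]
    · have := h z hz0 fun g hg => by simpa [aeval_eq_eval] using hz g hg
      simp [aeval_eq_eval, this]
  exact (Ideal.IsPrime.mem_or_mem ‹_› hmem).resolve_left hi

/-- A homogeneous prime of coheight at least two defines an irreducible set which is not a
point. -/
theorem exists_isIrredAlgebraic_lt {J J' : Ideal (MvPolynomial (Fin n) ℂ)} [J.IsPrime]
    [J'.IsPrime] (hhom : ∀ f ∈ J, ∀ d, homogeneousComponent d f ∈ J) (h1 : J < J')
    (h2 : J' < RingHom.ker constantCoeff) :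
    IsIrredAlgebraic (zeroSet {f | f ∈ J ∧ ∃ d : ℕ, f.IsHomogeneous d}) ∧
      ∃ p, {p} ⊂ zeroSet {f | f ∈ J ∧ ∃ d : ℕ, f.IsHomogeneous d} := by
  have hJ := h1.trans h2
  set S := {f | f ∈ J ∧ ∃ d : ℕ, f.IsHomogeneous d} with hSdef
  have hS : ∀ f ∈ S, ∃ d : ℕ, f.IsHomogeneous d := fun f hf => hf.2
  have hmem : ∀ (z : Cn n) (hz : z ≠ 0), Projectivization.mk ℂ z hz ∈ zeroSet S ↔
      ∀ g ∈ J, eval z g = 0 := by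
    intro z hz
    rw [mk_mem_zeroSet hS hz]
    refine ⟨fun h g hg => ?_, fun h g hg => h g hg.1⟩
    rw [← sum_homogeneousComponent g, map_sum]
    exact Finset.sum_eq_zero fun d _ =>
      h _ ⟨hhom g hg d, d, homogeneousComponent_isHomogeneous d g⟩
  have hne : (zeroSet S).Nonempty := by
    by_contra! hempty
    refine Ideal.IsPrime.ne_top ‹J.IsPrime› ((Ideal.eq_top_iff_one _).2
      (mem_of_forall_eval_eq_zero hJ fun z hz hz' => ?_))
    have := (hmem z hz).2 hz'
    rw [hempty] at this
    exact this.elim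
  refine ⟨⟨isAlgebraic_zeroSet hS, hne, ?_⟩, ?_⟩
  · rintro A B ⟨SA, hSA, hA⟩ ⟨SB, hSB, hB⟩ hAB
    by_contra! hnot
    obtain ⟨⟨a, haV, haA⟩, ⟨b, hbV, hbB⟩⟩ := And.imp Set.not_subset.1 Set.not_subset.1 hnot
    induction a using Projectivization.ind with | h a ha =>
    induction b using Projectivization.ind with | h b hb =>
    rw [hA] at haA
    rw [hB] at hbB
    push Not at haA hbB
    obtain ⟨f, hf, hfa⟩ := haA
    obtain ⟨g, hg, hgb⟩ := hbB
    have hfg : f * g ∈ J := by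
      refine mem_of_forall_eval_eq_zero hJ fun z hz hz' => ?_
      rw [map_mul]
      rcases hAB ((hmem z hz).2 hz') with h | h
      · rw [(hA z hz).1 h f hf, zero_mul]
      · rw [(hB z hz).1 h g hg, mul_zero]
    rcases Ideal.IsPrime.mem_or_mem ‹J.IsPrime› hfg with h | h
    · exact hfa ((hmem a ha).1 haV f h)
    · exact hgb ((hmem b hb).1 hbV g h)
  · obtain ⟨p, hp⟩ := hne
    refine ⟨p, Set.singleton_subset_iff.2 hp, fun hsub => ?_⟩
    induction p using Projectivization.ind with | h v hv =>
    -- Restriction to the line `ℂ v`. If the zero set were one point, the kernel of `φ` would lie in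
    -- `J`, so `J'` would correspond to a nonzero prime of `ℂ[t]`. It would then be maximal,
    -- contradicting `h2`.
    let φ : MvPolynomial (Fin n) ℂ →ₐ[ℂ] Polynomial ℂ :=
      aeval fun i => Polynomial.C (v i) * Polynomial.X
    obtain ⟨i, hi⟩ := Function.ne_iff.1 hv
    have hi' : v i ≠ 0 := hi
    have hsurj : Function.Surjective φ := by
      intro g
      refine ⟨Polynomial.aeval (C (v i)⁻¹ * X i) g, ?_⟩
      rw [← Polynomial.aeval_algHom_apply]
      have : φ (C (v i)⁻¹ * X i) = Polynomial.X := by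
        simp only [φ, map_mul, aeval_X, ← algebraMap_eq, AlgHom.commutes]
        rw [Polynomial.algebraMap_eq, ← mul_assoc, ← map_mul, inv_mul_cancel₀ hi', map_one,
          one_mul]
      rw [this, Polynomial.aeval_X_left_apply]
    have heval : ∀ (f : MvPolynomial (Fin n) ℂ) (t : ℂ),
        Polynomial.eval t (φ f) = eval (t • v) f := by
      intro f t
      have : (Polynomial.aeval t).comp φ = aeval (t • v) := by
        ext i
        rw [AlgHom.comp_apply, aeval_X]
        simp only [aeval_X, map_mul, Polynomial.aeval_C, Polynomial.aeval_X]
        exact mul_comm _ _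
      have := DFunLike.congr_fun this f
      simpa [aeval_eq_eval, Polynomial.coe_aeval_eq_eval] using this
    have hker : RingHom.ker φ ≤ J := by
      intro f hf
      refine mem_of_forall_eval_eq_zero hJ fun z hz hz' => ?_
      have := hsub ((hmem z hz).2 hz')
      rw [Set.mem_singleton_iff, Projectivization.mk_eq_mk_iff'] at this
      obtain ⟨a, rfl⟩ := this
      rw [← heval, RingHom.mem_ker.1 hf, Polynomial.eval_zero]
    have hpr : (J'.map φ).IsPrime := Ideal.map_isPrime_of_surjective hsurj (hker.trans h1.le)
    have hcm : (J'.map φ).comap φ = J' := by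
      rw [Ideal.comap_map_of_surjective _ hsurj, ← RingHom.ker_eq_comap_bot,
        sup_eq_left.2 (hker.trans h1.le)]
    have hbot : J'.map φ ≠ ⊥ := by
      intro h0
      rw [h0] at hcm
      exact h1.not_ge (hcm.symm.le.trans hker)
    have hmax : (J'.map φ).IsMaximal := hpr.isMaximal hbot
    have : ((J'.map φ).comap φ).IsMaximal := Ideal.comap_isMaximal_of_surjective φ hsurj
    rw [hcm] at this
    exact h2.ne (this.eq_of_le (RingHom.ker_ne_top _) h2.le)

/-- If a homogeneous vector field has no invariant algebraic set of intermediate dimension, then a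
set of homogeneous polynomials generating an invariant ideal, and contained in a prime
of coheight at least two, is zero. -/
theorem eq_zero_of_span_invariant (P : Fin n → MvPolynomial (Fin n) ℂ)
    (hinv : ∀ l : ℕ, 0 < l → l < n - 1 → ¬ ∃ V : Set (ProjSpace n), IsAlgebraic V ∧
      IsInvariant (fun z i => eval z (P i)) V ∧ dim V = l)
    {S : Set (MvPolynomial (Fin n) ℂ)} (hS : ∀ f ∈ S, ∃ d : ℕ, f.IsHomogeneous d)
    (hD : ∀ f ∈ S, mkDerivation ℂ P f ∈ Ideal.span S)
    {q q' : Ideal (MvPolynomial (Fin n) ℂ)} (hq : q.IsPrime) (hq' : q'.IsPrime) (hSq : S ⊆ q)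
    (h1 : q < q') (h2 : q' < RingHom.ker constantCoeff) : ∀ f ∈ S, f = 0 := by
  by_contra! hne0
  obtain ⟨f₀, hf₀, hf₀'⟩ := hne0
  obtain ⟨J, hJq, hJ, hhom, hJmem⟩ := exists_isPrime_homogeneous_le hq
  obtain ⟨hirr, p, hp⟩ := exists_isIrredAlgebraic_lt hhom (hJq.trans_lt h1) h2
  set W := zeroSet {f | f ∈ J ∧ ∃ d : ℕ, f.IsHomogeneous d} with hW
  have hWV : W ⊆ zeroSet S := fun x hx f hf => by
    obtain ⟨d, hd⟩ := hS f hf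
    exact hx f ⟨hJmem f (hSq hf) d hd, d, hd⟩
  have hVcone : coneIdeal (zeroSet S) ≠ ⊥ := by
    intro h0
    have : f₀ ∈ coneIdeal (zeroSet S) := fun z hz hzV => (mk_mem_zeroSet hS hz).1 hzV _ hf₀
    rw [h0] at this
    exact hf₀' this
  have hle := dim_le hVcone
  have hge : 1 ≤ dim (zeroSet S) := by
    rw [dim, Order.one_le_krullDim_iff]
    exact ⟨⟨{p}, isIrredAlgebraic_singleton p, hp.1.trans hWV⟩, ⟨W, hirr, hWV⟩, hp⟩
  obtain ⟨l, hl⟩ : ∃ l : ℕ, dim (zeroSet S) = l := by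
    obtain ⟨a, ha⟩ := WithBot.ne_bot_iff_exists.1
      (ne_bot_of_le_ne_bot (by simp) hge)
    rw [← ha] at hle ⊢
    have : a ≤ ((n - 2 : ℕ) : ℕ∞) := WithBot.coe_le_coe.1 hle
    obtain ⟨l, rfl⟩ := ENat.ne_top_iff_exists.1 (ne_top_of_le_ne_top (ENat.natCast_ne_top _) this)
    exact ⟨l, rfl⟩
  rw [hl] at hle hge
  have hl1 : 1 ≤ l := by exact_mod_cast hge
  have hl2 : l ≤ n - 2 := by exact_mod_cast hle
  refine hinv l hl1 (by omega) ⟨zeroSet S, isAlgebraic_zeroSet hS, ?_, hl⟩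
  intro d f hd hf z hz hzV
  have hDspan : ∀ g ∈ Ideal.span S, mkDerivation ℂ P g ∈ Ideal.span S := by
    intro g hg
    induction hg using Submodule.span_induction with
    | mem x hx => exact hD x hx
    | zero => simp
    | add x y _ _ hx hy => rw [map_add]; exact Ideal.add_mem _ hx hy
    | smul a x hx hx' =>
      rw [smul_eq_mul, Derivation.leibniz]
      exact Ideal.add_mem _ (Ideal.mul_mem_left _ _ hx')
        (by rw [smul_eq_mul, mul_comm]; exact Ideal.mul_mem_left _ _ hx)
  have hzS := (mk_mem_zeroSet hS hz).1 hzV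
  have hspan0 : ∀ g ∈ (Ideal.span S).radical, eval z g = 0 := by
    rintro g ⟨r, hr⟩
    have : Ideal.span S ≤ RingHom.ker (eval z) := Ideal.span_le.2 hzS
    have := RingHom.mem_ker.1 (this hr)
    rw [map_pow] at this
    exact eq_zero_of_pow_eq_zero this
  have hgoal : ∀ g ∈ (Ideal.span S).radical,
      ∑ i, eval z (P i) * eval z (pderiv i g) = 0 := by
    intro g hg
    have := hspan0 _ ((mkDerivation ℂ P).map_mem_radical hDspan hg)
    rw [mkDerivation_eq_sum, map_sum] at this
    simpa using this
  -- Vanishing on `V` says nothing about the origin, while the affine Nullstellensatz needs `f` to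
  -- vanish there too. Otherwise `f` is a constant and its derivatives are zero.
  by_cases hf0 : constantCoeff f = 0
  · refine hgoal f ?_
    rw [← vanishingIdeal_zeroLocus_eq_radical (K := ℂ), mem_vanishingIdeal_iff]
    intro w hw
    rw [aeval_eq_eval]
    by_cases hw0 : w = 0
    · rw [hw0]
      rwa [← MvPolynomial.eval_zero] at hf0
    · refine hf w hw0 ((mk_mem_zeroSet hS hw0).2 fun g hg => ?_)
      simpa [aeval_eq_eval] using hw g (Ideal.subset_span hg)
  · have : d = 0 := by
      by_contra hd0
      exact hf0 (by rw [constantCoeff_eq]; exact hd.coeff_eq_zero (by simpa using Ne.symm hd0))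
    subst this
    rw [← totalDegree_zero_iff_isHomogeneous, totalDegree_eq_zero_iff_eq_C] at hd
    rw [hd]
    simp

end ProjSpace

/-! ### Homogeneous vector fields without intermediate invariant sets -/

/-- The polynomial vector field `P` leaves no algebraic subset of `ℙⁿ⁻¹` of dimension strictly
between `0` and `n - 1` invariant. -/
def NoIntermediateInvariant {n : ℕ} (P : Fin n → MvPolynomial (Fin n) ℂ) : Prop :=
  ∀ l : ℕ, 0 < l → l < n - 1 → ¬ ∃ V : Set (ProjSpace n), ProjSpace.IsAlgebraic V ∧
    ProjSpace.IsInvariant (fun z i => eval z (P i)) V ∧ ProjSpace.dim V = l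

/-- The `2 × 2` minor in the rows `i`, `j` of the matrix with columns `x`, `y`. -/
def minorTwo {ι A : Type*} [CommRing A] (x y : ι → A) (i j : ι) : A := x i * y j - x j * y i

section Minors

variable {ι A : Type*} [Fintype ι] [CommRing A]

theorem sum_mul_minorThree (c x y z : ι → A) (j l : ι) :
    ∑ s, c s * minorThree x y z s j l =
      (∑ s, x s * c s) * (y j * z l - y l * z j) - (∑ s, y s * c s) * (x j * z l - x l * z j) +
        (∑ s, z s * c s) * (x j * y l - x l * y j) := by
  rw [Finset.sum_mul, Finset.sum_mul, Finset.sum_mul, ← Finset.sum_sub_distrib,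
    ← Finset.sum_add_distrib]
  refine Finset.sum_congr rfl fun s _ => ?_
  rw [minorThree]
  ring

theorem sum_mul_minorTwo (c x y : ι → A) (j : ι) :
    ∑ s, c s * minorTwo x y s j = (∑ s, x s * c s) * y j - x j * (∑ s, y s * c s) := by
  rw [Finset.sum_mul, Finset.mul_sum, ← Finset.sum_sub_distrib]
  refine Finset.sum_congr rfl fun s _ => ?_
  rw [minorTwo]
  ring

variable [Algebra ℂ A]

/-- Here `a` plays the Jacobian matrix of `P`. The columns `x` and `y` satisfy the linear system `D
v = a v`, while `D z = x` and `a z = k x`. The discrepancy in the third column is a multiple of `x`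
and disappears in the determinant, so the minors span an ideal stable under `D`. -/
theorem Derivation.apply_minorThree (D : Derivation ℂ A A) (a : ι → ι → A) (k : A)
    (x y z : ι → A) (hx : ∀ i, D (x i) = ∑ s, x s * a i s) (hy : ∀ i, D (y i) = ∑ s, y s * a i s)
    (hz : ∀ i, D (z i) = x i) (hzk : ∀ i, ∑ s, z s * a i s = k * x i) (i j l : ι) :
    D (minorThree x y z i j l) = ∑ s, a i s * minorThree x y z s j l -
      ∑ s, a j s * minorThree x y z s i l + ∑ s, a l s * minorThree x y z s i j := by
  simp only [sum_mul_minorThree, ← hx, ← hy, hzk]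
  simp only [minorThree, D.map_add, D.map_sub, D.leibniz, smul_eq_mul, hz]
  ring

theorem Derivation.apply_minorTwo (D : Derivation ℂ A A) (a : ι → ι → A) (k : A)
    (x z : ι → A) (hx : ∀ i, D (x i) = ∑ s, x s * a i s)
    (hz : ∀ i, D (z i) = x i) (hzk : ∀ i, ∑ s, z s * a i s = k * x i) (i j : ι) :
    D (minorTwo x z i j) = ∑ s, a i s * minorTwo x z s j - ∑ s, a j s * minorTwo x z s i := by
  simp only [sum_mul_minorTwo, ← hx, hzk]
  simp only [minorTwo, D.map_sub, D.leibniz, smul_eq_mul, hz]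
  ring

end Minors

namespace NoIntermediateInvariant

variable {n k : ℕ} {P : Fin n → MvPolynomial (Fin n) ℂ}

/-- The zero set of `S` contains the hypersurface `r = 0` through the origin, whose dimension is at
least 2 because `n ≥ 3`. -/
theorem eq_zero_of_common_factor (hn : 3 ≤ n) (hinv : NoIntermediateInvariant P)
    {S : Set (MvPolynomial (Fin n) ℂ)} (hS : ∀ f ∈ S, ∃ d : ℕ, f.IsHomogeneous d)
    (hD : ∀ f ∈ S, mkDerivation ℂ P f ∈ Ideal.span S) {r : MvPolynomial (Fin n) ℂ}
    (hr : constantCoeff r = 0) (hSr : ∀ f ∈ S, r ∣ f) : ∀ f ∈ S, f = 0 := by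
  obtain ⟨q, q', hq, hq', hrq, h1, h2⟩ := exists_lt_lt_ker_constantCoeff_of_mem hn hr
  exact ProjSpace.eq_zero_of_span_invariant P hinv hS hD hq hq'
    (fun f hf => Ideal.mem_of_dvd _ (hSr f hf) hrq) h1 h2

/-- Since `P` is homogeneous, it sends the components of `b` to distinct degrees, so each is itself
a first integral. One of positive degree spans an invariant ideal and is its own common factor,
hence is zero. -/
theorem eq_C_of_mkDerivation_eq_zero (hn : 3 ≤ n) (hP : ∀ i, (P i).IsHomogeneous k)
    (hinv : NoIntermediateInvariant P) {b : MvPolynomial (Fin n) ℂ}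
    (hb : mkDerivation ℂ P b = 0) : b = C (constantCoeff b) := by
  have hdeg : ∀ d, (mkDerivation ℂ P (homogeneousComponent (d + 1) b)).IsHomogeneous (k + d) := by
    intro d
    rw [mkDerivation_eq_sum]
    exact IsHomogeneous.sum _ _ _ fun i _ =>
      (hP i).mul (homogeneousComponent_isHomogeneous (d + 1) b).pderiv
  have hcomp : ∀ d, mkDerivation ℂ P (homogeneousComponent (d + 1) b) = 0 := by
    intro d
    by_cases hd : b.totalDegree < d + 1
    · rw [homogeneousComponent_eq_zero _ _ hd, map_zero]
    have h1 : mkDerivation ℂ P b = ∑ e ∈ Finset.range b.totalDegree,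
        mkDerivation ℂ P (homogeneousComponent (e + 1) b) := by
      conv_lhs => rw [← sum_homogeneousComponent b, map_sum, Finset.sum_range_succ']
      rw [homogeneousComponent_zero, derivation_C, add_zero]
    have h2 := congrArg (homogeneousComponent (k + d)) (hb.symm.trans h1)
    rw [map_zero, map_sum, Finset.sum_eq_single d] at h2
    · rw [homogeneousComponent_eq_self (hdeg d)] at h2
      exact h2.symm
    · intro e _ hed
      rw [homogeneousComponent_of_mem (hdeg e), if_neg (by omega)]
    · intro h
      exact absurd (Finset.mem_range.2 (by omega)) h
  have hzero : ∀ d, homogeneousComponent (d + 1) b = 0 := by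
    intro d
    refine hinv.eq_zero_of_common_factor hn (S := {homogeneousComponent (d + 1) b})
      (r := homogeneousComponent (d + 1) b) ?_ ?_ ?_ ?_ _ rfl
    · rintro _ rfl
      exact ⟨_, homogeneousComponent_isHomogeneous _ _⟩
    · rintro _ rfl
      rw [hcomp]
      exact Ideal.zero_mem _
    · rw [constantCoeff_eq]
      exact (homogeneousComponent_isHomogeneous (d + 1) b).coeff_eq_zero (by simp)
    · rintro _ rfl
      exact dvd_rfl
  conv_lhs => rw [← sum_homogeneousComponent b, Finset.sum_range_succ']
  rw [Finset.sum_eq_zero fun d _ => hzero d, zero_add, homogeneousComponent_zero, constantCoeff_eq]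

theorem _root_.MvPolynomial.exists_eq_mul_X_of_minorTwo_eq_zero (hn : 2 ≤ n)
    {V : Fin n → MvPolynomial (Fin n) ℂ} (h : ∀ i j, minorTwo V X i j = 0) :
    ∃ f, ∀ i, V i = f * X i := by
  have h01 : ∀ i j, V i * X j = V j * X i := fun i j => sub_eq_zero.1 (h i j)
  let i₀ : Fin n := ⟨0, by omega⟩
  let i₁ : Fin n := ⟨1, by omega⟩
  have hdvd : (X i₀ : MvPolynomial (Fin n) ℂ) ∣ V i₀ := by
    have hmul : (X i₀ : MvPolynomial (Fin n) ℂ) ∣ V i₀ * X i₁ :=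
      ⟨V i₁, by rw [h01 i₀ i₁, mul_comm]⟩
    refine (X_prime.dvd_or_dvd hmul).resolve_right ?_
    rw [X_dvd_X]
    simp [i₀, i₁]
  obtain ⟨f, hf⟩ := hdvd
  refine ⟨f, fun i => mul_right_cancel₀ (X_ne_zero (R := ℂ) i₀) ?_⟩
  rw [h01 i i₀, hf]
  ring

variable (hn : 3 ≤ n) (hk : 2 ≤ k) (hP : ∀ i, (P i).IsHomogeneous k)
  (hinv : NoIntermediateInvariant P)

include hn hk hP hinv

/-- Otherwise `P` is radial, `P = f X` with `f` vanishing at the origin because `k ≥ 2`. Then `f`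
divides all components of `P`, and these generate an ideal stable under `P`. -/
theorem exists_minorTwo_ne_zero (hP0 : P ≠ 0) : ∃ i j, minorTwo P X i j ≠ 0 := by
  by_contra! h
  obtain ⟨f, hf⟩ := exists_eq_mul_X_of_minorTwo_eq_zero (by omega) h
  refine hP0 (funext fun i => hinv.eq_zero_of_common_factor hn (S := Set.range P) (r := f)
    ?_ ?_ ?_ ?_ _ ⟨i, rfl⟩)
  · rintro _ ⟨i, rfl⟩
    exact ⟨k, hP i⟩
  · rintro _ ⟨i, rfl⟩
    rw [mkDerivation_eq_sum]
    exact Ideal.sum_mem _ fun s _ => Ideal.mul_mem_right _ _ (Ideal.subset_span ⟨s, rfl⟩)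
  · have h1 := (hP ⟨0, by omega⟩).coeff_eq_zero (d := Finsupp.single ⟨0, by omega⟩ 1)
      (by simp; omega)
    rw [hf, show (Finsupp.single (⟨0, by omega⟩ : Fin n) 1) =
      (0 + Finsupp.single (⟨0, by omega⟩ : Fin n) 1) by simp, coeff_mul_X] at h1
    exact h1
  · rintro _ ⟨i, rfl⟩
    exact ⟨X i, hf i⟩

theorem isUnit_of_forall_dvd_minorTwo (hP0 : P ≠ 0) {q : MvPolynomial (Fin n) ℂ}
    (hq : ∀ i j, q ∣ minorTwo P X i j) : IsUnit q := by
  by_contra hu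
  obtain ⟨i₀, j₀, h0⟩ := exists_minorTwo_ne_zero hn hk hP hinv hP0
  have hq0 : q ≠ 0 := fun h => h0 (zero_dvd_iff.1 (h ▸ hq i₀ j₀))
  obtain ⟨p, hp, hpq⟩ := WfDvdMonoid.exists_irreducible_factor hu hq0
  have hpp : Prime p := hp.prime
  have hhom : ∀ i j, (minorTwo P X i j).IsHomogeneous (k + 1) := fun i j =>
    ((hP i).mul (isHomogeneous_X _ j)).sub ((hP j).mul (isHomogeneous_X _ i))
  -- The irreducible factor `p` must be shown to vanish at the origin. The homogeneous core `J` of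
  -- `(p)` contains the homogeneous minor `p ^ a * c` with `p` not dividing `c`, so `p` lies in `J`;
  -- its constant term lies in `J` as well, and must be zero.
  obtain ⟨J, hJp, hJ, hJhom, hJmem⟩ := MvPolynomial.exists_isPrime_homogeneous_le
    ((Ideal.span_singleton_prime hpp.ne_zero).2 hpp)
  have hpJ : p ∈ J := by
    have hm : minorTwo P X i₀ j₀ ∈ J := hJmem _
      (Ideal.mem_span_singleton.2 (hpq.trans (hq i₀ j₀))) _ (hhom i₀ j₀)
    obtain ⟨c, hc, hpc⟩ := (FiniteMultiplicity.of_prime_left hpp h0).exists_eq_pow_mul_and_not_dvd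
    rw [hc] at hm
    rcases hJ.mem_or_mem hm with h | h
    · exact hJ.mem_of_pow_mem _ h
    · exact absurd (Ideal.mem_span_singleton.1 (hJp h)) hpc
  have hp0 : constantCoeff p = 0 := by
    have := hJhom p hpJ 0
    rw [homogeneousComponent_zero, ← constantCoeff_eq] at this
    by_contra hc
    refine hJ.ne_top ((Ideal.eq_top_iff_one _).2 ?_)
    have := J.mul_mem_left (C (constantCoeff p)⁻¹) this
    rwa [← C_mul, inv_mul_cancel₀ hc, C_1] at this
  refine h0 (hinv.eq_zero_of_common_factor hn
    (S := Set.range fun ij : Fin n × Fin n => minorTwo P X ij.1 ij.2) (r := p)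
    ?_ ?_ hp0 ?_ _ ⟨(i₀, j₀), rfl⟩)
  · rintro _ ⟨ij, rfl⟩
    exact ⟨_, hhom _ _⟩
  · rintro _ ⟨⟨i, j⟩, rfl⟩
    dsimp only
    rw [(mkDerivation ℂ P).apply_minorTwo (fun i s => pderiv s (P i)) (k : MvPolynomial (Fin n) ℂ)
      P X (fun i => mkDerivation_eq_sum _ _) (fun i => mkDerivation_X _ _ _)
      (fun i => by rw [(hP i).sum_X_mul_pderiv, nsmul_eq_mul])]
    have hsum : ∀ i j, ∑ s, pderiv s (P i) * minorTwo P X s j ∈ Ideal.span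
        (Set.range fun ij : Fin n × Fin n => minorTwo P X ij.1 ij.2) := fun i j =>
      Ideal.sum_mem _ fun s _ => Ideal.mul_mem_left _ _ (Ideal.subset_span ⟨(s, j), rfl⟩)
    exact Ideal.sub_mem _ (hsum _ _) (hsum _ _)
  · rintro _ ⟨ij, rfl⟩
    exact hpq.trans (hq _ _)

/-- A homogeneous polynomial vector field of positive degree commuting with `P` is a constant
multiple of `P`. -/
theorem exists_eq_C_mul (hP0 : P ≠ 0) {m : ℕ} (hm : 1 ≤ m)
    {Q : Fin n → MvPolynomial (Fin n) ℂ} (hQ : ∀ i, (Q i).IsHomogeneous m)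
    (hPQ : ∀ i, mkDerivation ℂ P (Q i) = mkDerivation ℂ Q (P i)) :
    ∃ c : ℂ, ∀ i, Q i = C c * P i := by
  have hcc : ∀ {d : ℕ} {f : MvPolynomial (Fin n) ℂ}, 1 ≤ d → f.IsHomogeneous d →
      constantCoeff f = 0 := fun hd hf => hf.coeff_eq_zero (by simp; omega)
  have hDP : ∀ i, mkDerivation ℂ P (P i) = ∑ s, P s * pderiv s (P i) :=
    fun i => mkDerivation_eq_sum _ _
  have hDQ : ∀ i, mkDerivation ℂ P (Q i) = ∑ s, Q s * pderiv s (P i) :=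
    fun i => (hPQ i).trans (mkDerivation_eq_sum _ _)
  have hDX : ∀ i, mkDerivation ℂ P (X i) = P i := fun i => mkDerivation_X _ _ _
  have hE : ∀ i, ∑ s, X s * pderiv s (P i) = (k : MvPolynomial (Fin n) ℂ) * P i :=
    fun i => by rw [(hP i).sum_X_mul_pderiv, nsmul_eq_mul]
  have hminor : ∀ i j l, minorThree P Q X i j l = 0 := by
    obtain ⟨q, q', hq, hq', hmem, h1, h2⟩ := exists_lt_lt_ker_constantCoeff_minorThree
      (by omega) P Q (fun i => hcc (by omega) (hP i)) (fun i => hcc hm (hQ i))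
    intro i j l
    refine ProjSpace.eq_zero_of_span_invariant P hinv
      (S := Set.range fun t : Fin n × Fin n × Fin n => minorThree P Q X t.1 t.2.1 t.2.2)
      ?_ ?_ hq hq' ?_ h1 h2 _ ⟨(i, j, l), rfl⟩
    · rintro _ ⟨⟨i, j, l⟩, rfl⟩
      refine ⟨k + (m + 1), ?_⟩
      have hX := isHomogeneous_X ℂ (σ := Fin n)
      have e1 := (hP i).mul (((hQ j).mul (hX l)).sub ((hQ l).mul (hX j)))
      have e2 := (hQ i).mul (((hP j).mul (hX l)).sub ((hP l).mul (hX j)))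
      have e3 := (hX i).mul (((hP j).mul (hQ l)).sub ((hP l).mul (hQ j)))
      rw [show m + (k + 1) = k + (m + 1) by ring] at e2
      rw [show 1 + (k + m) = k + (m + 1) by ring] at e3
      exact (e1.sub e2).add e3
    · rintro _ ⟨⟨i, j, l⟩, rfl⟩
      dsimp only
      rw [(mkDerivation ℂ P).apply_minorThree (fun i s => pderiv s (P i)) _ P Q X hDP hDQ hDX hE]
      have hsum : ∀ i j l, ∑ s, pderiv s (P i) * minorThree P Q X s j l ∈ Ideal.span
          (Set.range fun t : Fin n × Fin n × Fin n => minorThree P Q X t.1 t.2.1 t.2.2) :=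
        fun i j l => Ideal.sum_mem _ fun s _ =>
          Ideal.mul_mem_left _ _ (Ideal.subset_span ⟨(s, j, l), rfl⟩)
      exact Ideal.add_mem _ (Ideal.sub_mem _ (hsum _ _ _) (hsum _ _ _)) (hsum _ _ _)
    · rintro _ ⟨t, rfl⟩
      exact hmem _ _ _
  obtain ⟨i₀, j₀, h0⟩ := exists_minorTwo_ne_zero hn hk hP hinv hP0
  -- `p / q` is the reduced ratio of the `2 × 2` minors of `Q` to those of `P`. Vanishing of the `3
  -- × 3` minors makes this ratio independent of the rows, so `q` divides every minor of `P` and is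
  -- a unit.
  obtain ⟨q, p, c, hqp, hcq, hcp⟩ := UniqueFactorizationMonoid.exists_reduced_factors
    (minorTwo P X i₀ j₀) h0 (minorTwo Q X i₀ j₀)
  have hc : c ≠ 0 := by
    rintro rfl
    exact h0 (by rw [← hcq, zero_mul])
  have hqN : ∀ i j, q * minorTwo Q X i j = p * minorTwo P X i j := by
    intro i j
    refine mul_left_cancel₀ hc ?_
    rw [← mul_assoc, ← mul_assoc, hcq, hcp]
    have e1 := hminor i₀ j₀ i
    have e2 := hminor i₀ j₀ j
    simp only [minorThree, minorTwo] at e1 e2 ⊢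
    linear_combination X i * e2 - X j * e1
  have hqu : IsUnit q := isUnit_of_forall_dvd_minorTwo hn hk hP hinv hP0 fun i j =>
    hqp.dvd_of_dvd_mul_left ⟨_, (hqN i j).symm⟩
  obtain ⟨u, hu⟩ := hqu.exists_left_inv
  obtain ⟨b, hb⟩ := exists_eq_mul_X_of_minorTwo_eq_zero (n := n) (by omega)
    (V := fun i => Q i - u * p * P i) (fun i j => by
      have := hqN i j
      simp only [minorTwo] at this ⊢
      linear_combination u * this - (Q i * X j - Q j * X i) * hu)
  set a := u * p with ha
  have hQab : ∀ i, Q i = a * P i + b * X i := fun i => by linear_combination hb i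
  clear_value a
  -- The relation `[P, Q] = 0` with `Q = a P + b X` substituted, using Euler's identity for `P`. As
  -- `P` and `X` are independent, both coefficients vanish.
  have hrel : ∀ i, (mkDerivation ℂ P a - ((k : MvPolynomial (Fin n) ℂ) - 1) * b) * P i +
      mkDerivation ℂ P b * X i = 0 := by
    intro i
    have e1 := hDQ i
    have e2 : ∑ s, Q s * pderiv s (P i) =
        a * ∑ s, P s * pderiv s (P i) + b * ∑ s, X s * pderiv s (P i) := by
      rw [Finset.mul_sum, Finset.mul_sum, ← Finset.sum_add_distrib]
      exact Finset.sum_congr rfl fun s _ => by rw [hQab s]; ring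
    rw [e2, hE, ← hDP, hQab i, map_add, Derivation.leibniz, Derivation.leibniz, hDX] at e1
    simp only [smul_eq_mul] at e1
    linear_combination e1
  have hDa : mkDerivation ℂ P a = ((k : MvPolynomial (Fin n) ℂ) - 1) * b := by
    rw [← sub_eq_zero]
    refine (mul_eq_zero.1 ?_).resolve_right h0
    simp only [minorTwo]
    linear_combination X j₀ * hrel i₀ - X i₀ * hrel j₀
  have hDb : mkDerivation ℂ P b = 0 := by
    have := hrel i₀
    rw [hDa, sub_self, zero_mul, zero_add] at this
    exact (mul_eq_zero.1 this).resolve_right (X_ne_zero _)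
  have hbC := eq_C_of_mkDerivation_eq_zero hn hP hinv hDb
  have hb0 : b = 0 := by
    have := congrArg constantCoeff hDa
    rw [mkDerivation_eq_sum, map_sum, Finset.sum_eq_zero, map_mul, eq_comm, mul_eq_zero] at this
    · rcases this with h | h
      · rw [map_sub, map_natCast, map_one, sub_eq_zero] at h
        have : k = 1 := by exact_mod_cast h
        omega
      · rw [hbC, h, C_0]
    · intro i _
      rw [map_mul, hcc (by omega) (hP i), zero_mul]
  rw [hb0, mul_zero] at hDa
  refine ⟨constantCoeff a, fun i => ?_⟩
  rw [← eq_C_of_mkDerivation_eq_zero hn hP hinv hDa, hQab i, hb0, zero_mul, add_zero]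

end NoIntermediateInvariant

/-! ### Taylor expansions and leading parts of commuting germs -/

section Analysis

variable {n : ℕ}

/-- The homogeneous component of degree `j` of the Taylor series at `0`. -/
noncomputable def taylorComponent (f : Cn n → Cn n) (j : ℕ) (z : Cn n) : Cn n :=
  ((j.factorial : ℂ)⁻¹) • iteratedFDeriv ℂ j f 0 (fun _ => z)

theorem exists_polynomial_taylorComponent (f : Cn n → Cn n) (j : ℕ) :
    ∃ P : Fin n → MvPolynomial (Fin n) ℂ, (∀ i, (P i).IsHomogeneous j) ∧
      taylorComponent f j = fun z i => eval z (P i) := by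
  set M := iteratedFDeriv ℂ j f 0 with hM
  refine ⟨fun i => ∑ r : Fin j → Fin n,
    C ((j.factorial : ℂ)⁻¹ * M (fun s => Pi.single (r s) 1) i) * ∏ s, X (r s), fun i => ?_, ?_⟩
  · refine IsHomogeneous.sum _ _ _ fun r _ => IsHomogeneous.C_mul ?_ _
    have := IsHomogeneous.prod Finset.univ (fun s => (X (r s) : MvPolynomial (Fin n) ℂ))
      (fun _ => 1) (fun s _ => isHomogeneous_X _ _)
    simpa using this
  · funext z i
    have hz : (fun _ : Fin j => z) = fun _ => ∑ a, z a • (Pi.single a 1 : Cn n) := by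
      funext _ b
      simp [Pi.single_apply]
    rw [taylorComponent, ← hM, hz, ContinuousMultilinearMap.map_sum]
    simp only [ContinuousMultilinearMap.map_smul_univ, Pi.smul_apply, Finset.sum_apply,
      map_sum, map_mul, eval_C, map_prod, eval_X, smul_eq_mul, Finset.mul_sum]
    exact Finset.sum_congr rfl fun r _ => by ring

theorem AnalyticAt.isBigO_sub_sum_taylorComponent {f : Cn n → Cn n} (hf : AnalyticAt ℂ f 0)
    (N : ℕ) :
    (fun z => f z - ∑ j ∈ Finset.range N, taylorComponent f j z) =O[𝓝 0] fun z => ‖z‖ ^ N := by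
  obtain ⟨p, r, hp⟩ := hf
  have h := hp.hasFPowerSeriesAt.isBigO_sub_partialSum_pow N
  refine h.congr_left fun z => ?_
  rw [zero_add, FormalMultilinearSeries.partialSum]
  congr 1
  refine Finset.sum_congr rfl fun j _ => ?_
  rw [taylorComponent, ← hp.factorial_smul z j, ← Nat.cast_smul_eq_nsmul ℂ, smul_smul,
    inv_mul_cancel₀ (Nat.cast_ne_zero.2 j.factorial_ne_zero), one_smul]

theorem AnalyticAt.eventuallyEq_zero_of_taylorComponent {f : Cn n → Cn n}
    (hf : AnalyticAt ℂ f 0) (h : ∀ j, taylorComponent f j = 0) : f =ᶠ[𝓝 0] 0 := by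
  obtain ⟨p, r, hp⟩ := hf
  filter_upwards [Metric.eball_mem_nhds (0 : Cn n) hp.r_pos] with z hz
  have h1 := hp.hasSum_iteratedFDeriv hz
  have h2 : (fun j : ℕ => (j.factorial : ℂ)⁻¹ • iteratedFDeriv ℂ j f 0 fun _ => z) = 0 :=
    funext fun j => congrFun (h j) z
  rw [h2, zero_add] at h1
  exact h1.unique hasSum_zero

/-- Cauchy's estimate for the derivative of a holomorphic map vanishing to order `N`. -/
theorem AnalyticAt.isBigO_norm_smul_fderiv {r : Cn n → Cn n} (hr : AnalyticAt ℂ r 0) {N : ℕ}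
    (h : r =O[𝓝 0] fun z => ‖z‖ ^ N) :
    (fun z => ‖z‖ * ‖fderiv ℂ r z‖) =O[𝓝[≠] 0] fun z => ‖z‖ ^ N := by
  obtain ⟨K, hK, hb⟩ := h.exists_pos
  rw [isBigOWith_iff] at hb
  obtain ⟨ε, hε, hball⟩ := Metric.eventually_nhds_iff.1 (hb.and hr.eventually_analyticAt)
  -- The estimate is applied in each direction `w` on the disc of radius `‖x‖ / ‖w‖`, on which `x +
  -- s • w` stays in the ball of radius `2 * ‖x‖`. This accounts for `2 ^ N` and for the radius `ε /
  -- 2`.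
  refine IsBigO.of_bound (K * 2 ^ N) ?_
  have hnhds : ∀ᶠ z in 𝓝[≠] (0 : Cn n), dist z 0 < ε / 2 :=
    nhdsWithin_le_nhds (Metric.ball_mem_nhds _ (half_pos hε))
  filter_upwards [hnhds, self_mem_nhdsWithin] with x hx hx0
  have hx0' : 0 < ‖x‖ := norm_pos_iff.2 hx0
  rw [dist_zero_right] at hx
  have hfd : ‖fderiv ℂ r x‖ ≤ K * (2 * ‖x‖) ^ N / ‖x‖ := by
    refine ContinuousLinearMap.opNorm_le_bound _ (by positivity) fun w => ?_
    by_cases hw : w = 0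
    · simp [hw]
    have hw' : 0 < ‖w‖ := norm_pos_iff.2 hw
    have hin : ∀ s : ℂ, ‖s‖ ≤ ‖x‖ / ‖w‖ → ‖x + s • w‖ ≤ 2 * ‖x‖ := by
      intro s hs
      have h1 : ‖s • w‖ ≤ ‖x‖ := by
        rw [norm_smul]
        exact (le_div_iff₀ hw').1 hs
      linarith [norm_add_le x (s • w)]
    have hgood : ∀ s : ℂ, ‖s‖ ≤ ‖x‖ / ‖w‖ →
        ‖r (x + s • w)‖ ≤ K * ‖x + s • w‖ ^ N ∧ AnalyticAt ℂ r (x + s • w) := by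
      intro s hs
      have h1 := hball (y := x + s • w) (by
        rw [dist_zero_right]
        linarith [hin s hs])
      simpa using h1
    have hdiff : ∀ s : ℂ, ‖s‖ ≤ ‖x‖ / ‖w‖ → HasDerivAt (fun s : ℂ => r (x + s • w))
        (fderiv ℂ r (x + s • w) w) s := by
      intro s hs
      have h1 : HasDerivAt (fun s : ℂ => x + s • w) w s := by
        simpa using ((hasDerivAt_id s).smul_const w).const_add x
      exact (hgood s hs).2.differentiableAt.hasFDerivAt.comp_hasDerivAt s h1
    have hR : 0 < ‖x‖ / ‖w‖ := by positivity
    have hcauchy := Complex.norm_deriv_le_of_forall_mem_sphere_norm_le (c := 0)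
      (R := ‖x‖ / ‖w‖) (C := K * (2 * ‖x‖) ^ N) (f := fun s : ℂ => r (x + s • w)) hR ?_ ?_
    · rw [(hdiff 0 (by simpa using hR.le)).deriv, zero_smul, add_zero] at hcauchy
      refine hcauchy.trans (le_of_eq ?_)
      field_simp
    · refine DifferentiableOn.diffContOnCl_ball (U := Metric.closedBall 0 (‖x‖ / ‖w‖))
        (fun s hs => ?_) le_rfl
      exact (hdiff s (by simpa using hs)).differentiableAt.differentiableWithinAt
    · intro s hs
      have hs' : ‖s‖ ≤ ‖x‖ / ‖w‖ := by
        rw [mem_sphere_zero_iff_norm] at hs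
        exact hs.le
      refine (hgood s hs').1.trans ?_
      gcongr
      exact hin s hs'
  rw [norm_mul, norm_norm, norm_norm, norm_pow, norm_norm]
  calc ‖x‖ * ‖fderiv ℂ r x‖ ≤ ‖x‖ * (K * (2 * ‖x‖) ^ N / ‖x‖) := by gcongr
    _ = K * 2 ^ N * ‖x‖ ^ N := by
      field_simp
      ring

theorem MvPolynomial.hasFDerivAt_eval (f : MvPolynomial (Fin n) ℂ) (x : Cn n) :
    HasFDerivAt (fun z : Cn n => eval z f)
      (∑ s, eval x (pderiv s f) • ContinuousLinearMap.proj s : Cn n →L[ℂ] ℂ) x := by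
  induction f using MvPolynomial.induction_on with
  | C a =>
    simp only [eval_C]
    refine (hasFDerivAt_const (𝕜 := ℂ) a x).congr_fderiv ?_
    ext w
    simp
  | add p q hp hq =>
    simp only [map_add]
    refine (hp.add hq).congr_fderiv ?_
    ext w
    simp [add_mul, Finset.sum_add_distrib]
  | mul_X p i hp =>
    simp only [map_mul, eval_X]
    refine (hp.mul (hasFDerivAt_apply (𝕜 := ℂ) i x)).congr_fderiv ?_
    ext w
    simp [pderiv_X, Pi.single_apply, add_mul, Finset.sum_add_distrib, Finset.mul_sum, mul_assoc,
      apply_ite (eval x)]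

/-- The bracket of two polynomial vector fields. -/
theorem lieBracket_eval (P Q : Fin n → MvPolynomial (Fin n) ℂ) (x : Cn n) :
    lieBracket ℂ (fun z i => eval z (P i)) (fun z i => eval z (Q i)) x =
      fun i => eval x (mkDerivation ℂ P (Q i) - mkDerivation ℂ Q (P i)) := by
  have h : ∀ R : Fin n → MvPolynomial (Fin n) ℂ, HasFDerivAt (fun (z : Cn n) i => eval z (R i))
      (ContinuousLinearMap.pi fun i => ∑ s, eval x (pderiv s (R i)) •
        ContinuousLinearMap.proj (R := ℂ) (φ := fun _ => ℂ) s) x :=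
    fun R => hasFDerivAt_pi.2 fun i => hasFDerivAt_eval (R i) x
  funext i
  rw [lieBracket, (h P).fderiv, (h Q).fderiv, mkDerivation_eq_sum, mkDerivation_eq_sum]
  simp [mul_comm]

theorem MvPolynomial.analyticAt_eval (P : Fin n → MvPolynomial (Fin n) ℂ) (x : Cn n) :
    AnalyticAt ℂ (fun (z : Cn n) i => eval z (P i)) x := by
  refine AnalyticAt.pi fun i => ?_
  have := AnalyticAt.aeval_mvPolynomial (f := fun z : Cn n => z) (z := x)
    (fun j => (ContinuousLinearMap.proj (R := ℂ) (φ := fun _ : Fin n => ℂ) j).analyticAt x) (P i)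
  simpa [aeval_eq_eval] using this

/-- The leading homogeneous parts of commuting vector fields commute. -/
theorem mkDerivation_comm_of_lieBracket_eq_zero (hn : 1 ≤ n) {f g : Cn n → Cn n}
    (hf : AnalyticAt ℂ f 0) (hg : AnalyticAt ℂ g 0) (hfg : lieBracket ℂ f g =ᶠ[𝓝 0] 0)
    {k m : ℕ} (hk : 2 ≤ k) {P Q : Fin n → MvPolynomial (Fin n) ℂ}
    (hP : ∀ i, (P i).IsHomogeneous k) (hQ : ∀ i, (Q i).IsHomogeneous m)
    (hfk : f =O[𝓝 0] fun z => ‖z‖ ^ k)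
    (hfP : (fun z => f z - fun i => eval z (P i)) =O[𝓝 0] fun z => ‖z‖ ^ (k + 1))
    (hgm : g =O[𝓝 0] fun z => ‖z‖ ^ m)
    (hgQ : (fun z => g z - fun i => eval z (Q i)) =O[𝓝 0] fun z => ‖z‖ ^ (m + 1)) (i : Fin n) :
    mkDerivation ℂ P (Q i) = mkDerivation ℂ Q (P i) := by
  set p : Cn n → Cn n := fun z i => eval z (P i) with hp
  set q : Cn n → Cn n := fun z i => eval z (Q i) with hq
  set r : Cn n → Cn n := fun z => f z - p z with hr
  set s : Cn n → Cn n := fun z => g z - q z with hs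
  have hpa : ∀ x, AnalyticAt ℂ p x := analyticAt_eval P
  have hqa : ∀ x, AnalyticAt ℂ q x := analyticAt_eval Q
  have hra : AnalyticAt ℂ r 0 := hf.sub (hpa 0)
  have hsa : AnalyticAt ℂ s 0 := hg.sub (hqa 0)
  have hpow : ∀ a : ℕ, (fun z : Cn n => ‖z‖ ^ (a + 1)) =O[𝓝 0] fun z => ‖z‖ ^ a := by
    intro a
    refine IsBigO.of_bound 1 ?_
    filter_upwards [Metric.ball_mem_nhds (0 : Cn n) one_pos] with z hz
    rw [mem_ball_zero_iff] at hz
    rw [norm_pow, norm_pow, norm_norm, one_mul]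
    exact pow_le_pow_of_le_one (norm_nonneg _) hz.le (Nat.le_succ a)
  have hqm : q =O[𝓝 0] fun z => ‖z‖ ^ m := by
    have : q = fun z => g z - s z := by funext z; simp [hs]
    rw [this]
    exact hgm.sub (hgQ.trans (hpow m))
  have hpk : p =O[𝓝 0] fun z => ‖z‖ ^ k := by
    have : p = fun z => f z - r z := by funext z; simp [hr]
    rw [this]
    exact hfk.sub (hfP.trans (hpow k))
  -- The weight `‖z‖` compensates the order lost by differentiation, so orders add without
  -- subtraction in the exponent.
  have hmul : ∀ {h v : Cn n → Cn n} {a b : ℕ}, AnalyticAt ℂ h 0 →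
      h =O[𝓝 0] (fun z => ‖z‖ ^ a) → v =O[𝓝 0] (fun z => ‖z‖ ^ b) → a + b = k + m + 1 →
      (fun z => (‖z‖ : ℂ) • fderiv ℂ h z (v z)) =O[𝓝[≠] 0] fun z => ‖z‖ ^ (k + m + 1) := by
    intro h v a b ha h1 h2 hab
    have h3 := (ha.isBigO_norm_smul_fderiv h1).mul (h2.mono nhdsWithin_le_nhds).norm_left
    simp only [← pow_add, hab] at h3
    refine IsBigO.trans (IsBigO.of_bound 1 (Eventually.of_forall fun z => ?_)) h3
    rw [norm_smul, Complex.norm_real, norm_norm, one_mul, norm_mul, norm_mul, norm_norm, norm_norm,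
      norm_norm, mul_assoc]
    gcongr
    exact ContinuousLinearMap.le_opNorm _ _
  have hB : (fun z => (‖z‖ : ℂ) • lieBracket ℂ p q z) =O[𝓝[≠] 0] fun z => ‖z‖ ^ (k + m + 1) := by
    have h1 := hmul (hqa 0) hqm hfP (by ring)
    have h2 := hmul hsa hgQ hfk (by ring)
    have h3 := hmul (hpa 0) hpk hgQ (by ring)
    have h4 := hmul hra hfP hgm (by ring)
    -- `[p, q] - [f, g]` is a combination of four terms, each containing a remainder `r` or `s` and
    -- hence one order higher than `[p, q]`.
    refine (((h3.add h4).sub h1).sub h2).congr' ?_ EventuallyEq.rfl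
    filter_upwards [nhdsWithin_le_nhds hfg, nhdsWithin_le_nhds hf.eventually_analyticAt,
      nhdsWithin_le_nhds hg.eventually_analyticAt] with z hz hfz hgz
    have e1 : fderiv ℂ r z = fderiv ℂ f z - fderiv ℂ p z :=
      fderiv_fun_sub hfz.differentiableAt (hpa z).differentiableAt
    have e2 : fderiv ℂ s z = fderiv ℂ g z - fderiv ℂ q z :=
      fderiv_fun_sub hgz.differentiableAt (hqa z).differentiableAt
    have e3 : fderiv ℂ g z (f z) - fderiv ℂ f z (g z) = 0 := hz
    rw [← smul_add, ← smul_sub, ← smul_sub, lieBracket, e1, e2]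
    congr 1
    have e4 : fderiv ℂ g z (f z) = fderiv ℂ f z (g z) := sub_eq_zero.1 e3
    simp only [sub_apply, map_sub, hr, hs, e4]
    abel
  have hhom : (mkDerivation ℂ P (Q i) - mkDerivation ℂ Q (P i)).IsHomogeneous (k + m - 1) := by
    refine IsHomogeneous.sub ?_ ?_
    · rw [mkDerivation_eq_sum]
      -- For `m = 0` the truncated degree `m - 1` would be off by one, but then the derivatives of
      -- `Q` vanish.
      rcases m with _ | m
      · have : ∀ s, pderiv s (Q i) = 0 := by
          intro s
          have h := hQ i
          rw [← totalDegree_zero_iff_isHomogeneous, totalDegree_eq_zero_iff_eq_C] at h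
          rw [h, pderiv_C]
        simp only [this, mul_zero, Finset.sum_const_zero]
        exact isHomogeneous_zero _ _ _
      · exact IsHomogeneous.sum _ _ _ fun s _ => (hP s).mul (hQ i).pderiv
    · rw [mkDerivation_eq_sum, show k + m - 1 = m + (k - 1) by omega]
      exact IsHomogeneous.sum _ _ _ fun s _ => (hQ s).mul (hP i).pderiv
  set b := mkDerivation ℂ P (Q i) - mkDerivation ℂ Q (P i) with hb
  have hz : ∀ z : Cn n, z ≠ 0 → eval z b = 0 := by
    intro z hz
    have htend : Tendsto (fun t : ℂ => t • z) (𝓝[≠] 0) (𝓝[≠] 0) := by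
      refine tendsto_nhdsWithin_of_tendsto_nhds_of_eventually_within _ ?_ ?_
      · have : Tendsto (fun t : ℂ => t • z) (𝓝 0) (𝓝 ((0 : ℂ) • z)) :=
          (continuous_id.smul continuous_const).tendsto 0
        rw [zero_smul] at this
        exact this.mono_left nhdsWithin_le_nhds
      · filter_upwards [self_mem_nhdsWithin] with t ht
        exact smul_ne_zero ht hz
    obtain ⟨K, hK⟩ := (hB.comp_tendsto htend).bound
    -- Along the line through `z` the weighted bracket is homogeneous of order `k + m` in `t`, yet
    -- bounded by order `k + m + 1`; dividing leaves a factor `‖t‖` that tends to zero.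
    have hle : ∀ᶠ t : ℂ in 𝓝[≠] 0, ‖eval z b‖ ≤ K * ‖z‖ ^ (k + m) * ‖t‖ := by
      filter_upwards [hK, self_mem_nhdsWithin] with t ht ht0
      have ht0' : 0 < ‖t‖ := norm_pos_iff.2 ht0
      have hz' : 0 < ‖z‖ := norm_pos_iff.2 hz
      simp only [Function.comp_apply, norm_smul, Complex.norm_real, norm_pow, norm_mul,
        norm_norm] at ht
      have h1 : ‖eval (t • z) b‖ ≤ ‖lieBracket ℂ p q (t • z)‖ := by
        have h2 := congrFun (lieBracket_eval P Q (t • z)) i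
        rw [hb, ← h2]
        exact norm_le_pi_norm (lieBracket ℂ p q (t • z)) i
      rw [hhom.eval_smul, norm_mul, norm_pow] at h1
      have h3 : ‖t‖ * ‖z‖ * (‖t‖ ^ (k + m - 1) * ‖eval z b‖) ≤ K * (‖t‖ * ‖z‖) ^ (k + m + 1) :=
        le_trans (by gcongr) ht
      have h4 : (0 : ℝ) < ‖t‖ ^ (k + m) * ‖z‖ := by positivity
      refine le_of_mul_le_mul_left ?_ h4
      calc ‖t‖ ^ (k + m) * ‖z‖ * ‖eval z b‖
          = ‖t‖ * ‖z‖ * (‖t‖ ^ (k + m - 1) * ‖eval z b‖) := by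
            rw [show k + m = (k + m - 1) + 1 by omega, Nat.add_sub_cancel, pow_succ]
            ring
        _ ≤ K * (‖t‖ * ‖z‖) ^ (k + m + 1) := h3
        _ = ‖t‖ ^ (k + m) * ‖z‖ * (K * ‖z‖ ^ (k + m) * ‖t‖) := by ring
    have hlim : Tendsto (fun t : ℂ => K * ‖z‖ ^ (k + m) * ‖t‖) (𝓝[≠] 0) (𝓝 0) := by
      have : Tendsto (fun t : ℂ => K * ‖z‖ ^ (k + m) * ‖t‖) (𝓝 0)
          (𝓝 (K * ‖z‖ ^ (k + m) * ‖(0 : ℂ)‖)) :=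
        (continuous_const.mul continuous_norm).tendsto 0
      rw [norm_zero, mul_zero] at this
      exact this.mono_left nhdsWithin_le_nhds
    exact norm_le_zero_iff.1 (ge_of_tendsto hlim hle)
  have hXb : X ⟨0, hn⟩ * b = 0 := by
    apply MvPolynomial.funext
    intro z
    rw [map_mul, eval_X, map_zero]
    by_cases h0 : z = 0
    · simp [h0]
    · rw [hz z h0, mul_zero]
  exact sub_eq_zero.1 ((mul_eq_zero.1 hXb).resolve_left (X_ne_zero _))

/-- A constant vector field does not commute with a homogeneous vector field having an isolated
zero. -/
theorem eq_zero_of_isHomogeneous_zero {k : ℕ} (hk : 1 ≤ k) {P Q : Fin n → MvPolynomial (Fin n) ℂ}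
    (hP : ∀ i, (P i).IsHomogeneous k) (hQ : ∀ i, (Q i).IsHomogeneous 0)
    (hiso : HasIsolatedSingularity fun z i => eval z (P i))
    (hPQ : ∀ i, mkDerivation ℂ P (Q i) = mkDerivation ℂ Q (P i)) : Q = 0 := by
  have hQC : ∀ i, Q i = C (coeff 0 (Q i)) := fun i => by
    have h := hQ i
    rwa [← totalDegree_zero_iff_isHomogeneous, totalDegree_eq_zero_iff_eq_C] at h
  set c : Cn n := fun i => coeff 0 (Q i) with hc
  have hPc : ∀ i, eval c (P i) = 0 := by
    intro i
    have h1 := hPQ i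
    rw [hQC i, derivation_C, mkDerivation_eq_sum] at h1
    have h2 := congrArg (eval c) h1
    have h3 := congrArg (eval c) (hP i).sum_X_mul_pderiv
    rw [map_zero, map_sum] at h2
    rw [map_sum, nsmul_eq_mul, map_mul, map_natCast] at h3
    -- Euler's identity at the point `c` itself: the derivative of `P i` in the direction `c`
    -- vanishes there, so `P` vanishes on the whole line `ℂ c`.
    have h4 : (k : ℂ) * eval c (P i) = 0 := by
      rw [← h3, h2]
      refine Finset.sum_congr rfl fun s _ => ?_
      rw [map_mul, map_mul, eval_X]
      conv_rhs => rw [hQC s, eval_C]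
    exact (mul_eq_zero.1 h4).resolve_left (Nat.cast_ne_zero.2 (by omega))
  have hc0 : c = 0 := by
    by_contra hc0
    have htend : Tendsto (fun t : ℂ => t • c) (𝓝[≠] 0) (𝓝[≠] 0) := by
      refine tendsto_nhdsWithin_of_tendsto_nhds_of_eventually_within _ ?_ ?_
      · have : Tendsto (fun t : ℂ => t • c) (𝓝 0) (𝓝 ((0 : ℂ) • c)) :=
          (continuous_id.smul continuous_const).tendsto 0
        rw [zero_smul] at this
        exact this.mono_left nhdsWithin_le_nhds
      · filter_upwards [self_mem_nhdsWithin] with t ht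
        exact smul_ne_zero ht hc0
    obtain ⟨t, ht⟩ := (htend.eventually hiso.2).exists
    refine ht (funext fun i => ?_)
    change eval (t • c) (P i) = 0
    rw [(hP i).eval_smul, hPc, mul_zero]
  funext i
  rw [hQC i, show coeff 0 (Q i) = c i from rfl, hc0]
  simp

theorem taylorComponent_sub_smul {f g : Cn n → Cn n} (hf : AnalyticAt ℂ f 0)
    (hg : AnalyticAt ℂ g 0) (c : ℂ) (j : ℕ) :
    taylorComponent (g - c • f) j = taylorComponent g j - c • taylorComponent f j := by
  funext z
  have hf' : ContDiffAt ℂ j f 0 := hf.contDiffAt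
  have hcf : ContDiffAt ℂ j (c • f) 0 := hf'.const_smul c
  have hg' : ContDiffAt ℂ j g 0 := hg.contDiffAt
  simp only [taylorComponent, Pi.sub_apply, Pi.smul_apply]
  rw [iteratedFDeriv_sub_apply hg' hcf, iteratedFDeriv_const_smul_apply hf',
    sub_apply, smul_apply, smul_sub,
    smul_comm]

variable (hn : 3 ≤ n) {k : ℕ} (hk : 2 ≤ k) {f : Cn n → Cn n} (hf : AnalyticAt ℂ f 0)
  (hlow : ∀ j < k, taylorComponent f j = 0) (hfk : taylorComponent f k ≠ 0)
  (hiso : HasIsolatedSingularity (taylorComponent f k))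
  (hinv : ∀ l : ℕ, 0 < l → l < n - 1 → ¬ ∃ V : Set (ProjSpace n), ProjSpace.IsAlgebraic V ∧
    ProjSpace.IsInvariant (taylorComponent f k) V ∧ ProjSpace.dim V = l)

include hn hk hf hlow hfk hiso hinv

theorem exists_taylorComponent_eq_smul {g : Cn n → Cn n} (hg : AnalyticAt ℂ g 0)
    (hfg : lieBracket ℂ f g =ᶠ[𝓝 0] 0) {m : ℕ} (hgm : ∀ j < m, taylorComponent g j = 0)
    (hg0 : taylorComponent g m ≠ 0) :
    m = k ∧ ∃ c : ℂ, taylorComponent g m = c • taylorComponent f k := by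
  obtain ⟨P, hP, hfP⟩ := exists_polynomial_taylorComponent f k
  obtain ⟨Q, hQ, hgQ⟩ := exists_polynomial_taylorComponent g m
  have hlead : ∀ {h : Cn n → Cn n} {j : ℕ}, AnalyticAt ℂ h 0 → (∀ i < j, taylorComponent h i = 0) →
      h =O[𝓝 0] (fun z => ‖z‖ ^ j) ∧
      (fun z => h z - taylorComponent h j z) =O[𝓝 0] fun z => ‖z‖ ^ (j + 1) := by
    intro h j hh hj
    have hsum : ∀ z, ∑ i ∈ Finset.range j, taylorComponent h i z = 0 := fun z =>
      Finset.sum_eq_zero fun i hi => congrFun (hj i (Finset.mem_range.1 hi)) z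
    have h1 := hh.isBigO_sub_sum_taylorComponent j
    have h2 := hh.isBigO_sub_sum_taylorComponent (j + 1)
    simp only [Finset.sum_range_succ, hsum, zero_add, sub_zero] at h1 h2
    exact ⟨h1, h2⟩
  obtain ⟨h1, h2⟩ := hlead hf hlow
  obtain ⟨h3, h4⟩ := hlead hg hgm
  rw [hfP] at h2 hiso hinv
  rw [hgQ] at h4
  have hPQ := mkDerivation_comm_of_lieBracket_eq_zero (by omega) hf hg hfg hk hP hQ h1 h2 h3 h4
  have hP0 : P ≠ 0 := by
    rintro rfl
    exact hfk (hfP.trans (by funext z i; simp))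
  have hQ0 : Q ≠ 0 := by
    rintro rfl
    exact hg0 (hgQ.trans (by funext z i; simp))
  have hm : 1 ≤ m := by
    by_contra hm
    obtain rfl : m = 0 := by omega
    exact hQ0 (eq_zero_of_isHomogeneous_zero (by omega) hP hQ hiso hPQ)
  obtain ⟨c, hc⟩ := NoIntermediateInvariant.exists_eq_C_mul hn hk hP hinv hP0 hm hQ hPQ
  refine ⟨?_, c, ?_⟩
  · obtain ⟨i, hi⟩ := Function.ne_iff.1 hQ0
    have := hQ i
    rw [hc i] at this
    exact this.inj_right ((hP i).C_mul c) (by rw [← hc i]; exact hi)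
  · rw [hgQ, hfP]
    funext z i
    simp [hc i]

theorem exists_eventuallyEq_smul_of_lieBracket_eq_zero {g : Cn n → Cn n} (hg : AnalyticAt ℂ g 0)
    (hfg : lieBracket ℂ f g =ᶠ[𝓝 0] 0) : ∃ c : ℂ, g =ᶠ[𝓝 0] c • f := by
  classical
  by_cases hzero : ∀ j, taylorComponent g j = 0
  · refine ⟨0, ?_⟩
    rw [zero_smul]
    exact hg.eventuallyEq_zero_of_taylorComponent hzero
  push Not at hzero
  obtain ⟨hmk, c, hc⟩ := exists_taylorComponent_eq_smul hn hk hf hlow hfk hiso hinv hg hfg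
    (fun j hj => not_not.1 (Nat.find_min hzero hj)) (Nat.find_spec hzero)
  have hglow : ∀ j < k, taylorComponent g j = 0 := fun j hj =>
    not_not.1 (Nat.find_min hzero (hmk ▸ hj))
  rw [hmk] at hc
  have hcf : AnalyticAt ℂ (c • f) 0 := analyticAt_const.smul hf
  have hg' : AnalyticAt ℂ (g - c • f) 0 := hg.sub hcf
  have hfg' : lieBracket ℂ f (g - c • f) =ᶠ[𝓝 0] 0 := by
    filter_upwards [hfg, hf.eventually_analyticAt, hg.eventually_analyticAt] with z hz hfz hgz
    have e1 : fderiv ℂ (g - c • f) z = fderiv ℂ g z - c • fderiv ℂ f z := by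
      rw [fderiv_sub hgz.differentiableAt (hfz.differentiableAt.const_smul c),
        fderiv_const_smul hfz.differentiableAt]
    have e2 : fderiv ℂ g z (f z) - fderiv ℂ f z (g z) = 0 := hz
    rw [lieBracket, e1]
    simp only [sub_apply, smul_apply, Pi.sub_apply,
      Pi.smul_apply, map_sub, map_smul, Pi.zero_apply]
    rw [← e2]
    abel
  refine ⟨c, ?_⟩
  by_cases hzero' : ∀ j, taylorComponent (g - c • f) j = 0
  · filter_upwards [hg'.eventuallyEq_zero_of_taylorComponent hzero'] with z hz
    exact sub_eq_zero.1 hz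
  push Not at hzero'
  obtain ⟨hmk', -⟩ := exists_taylorComponent_eq_smul hn hk hf hlow hfk hiso hinv hg' hfg'
    (fun j hj => not_not.1 (Nat.find_min hzero' hj)) (Nat.find_spec hzero')
  -- The difference `g - c • f` commutes with `f`, so its order would again be `k`; but `c` was
  -- chosen to cancel its component of degree `k`.
  refine absurd ?_ (Nat.find_spec hzero')
  rw [hmk', taylorComponent_sub_smul hf hg, hc, sub_self]

end Analysis

/-! ### The centralizer of a germ -/

theorem propositionp (n : ℕ) (hn : 3 ≤ n) (k : ℕ) (hk : 2 ≤ k) (X : VectorFieldGerm n)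
    (hlow : ∀ j < k, VectorFieldGerm.homogeneousPart X j = 0)
    (hXk : VectorFieldGerm.homogeneousPart X k ≠ 0)
    (hiso : HasIsolatedSingularity (VectorFieldGerm.homogeneousPart X k))
    (hinv : ∀ l : ℕ, 0 < l → l < n - 1 →
      ¬ ∃ V : Set (ProjSpace n), ProjSpace.IsAlgebraic V ∧
        ProjSpace.IsInvariant (VectorFieldGerm.homogeneousPart X k) V ∧ ProjSpace.dim V = l) :
    VectorFieldGerm.centralizer X = {Y : VectorFieldGerm n | ∃ c : ℂ, Y = c • X} := by
  obtain ⟨_, f, hf, rfl⟩ := X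
  ext ⟨_, g, hg, rfl⟩
  constructor
  · intro h
    have hfg : VectorField.lieBracket ℂ f g =ᶠ[𝓝 0] 0 := Germ.coe_eq.1 h
    obtain ⟨c, hc⟩ := exists_eventuallyEq_smul_of_lieBracket_eq_zero hn hk hf hlow hXk hiso hinv
      hg hfg
    exact ⟨c, Subtype.ext (Germ.coe_eq.2 hc)⟩
  · rintro ⟨c, hc⟩
    have hgc : g =ᶠ[𝓝 0] c • f := Germ.coe_eq.1 (congrArg Subtype.val hc)
    refine Germ.coe_eq.2 ?_
    refine (EventuallyEq.rfl.lieBracket_vectorField (𝕜 := ℂ) hgc).trans ?_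
    filter_upwards [hf.eventually_analyticAt] with z hz
    rw [VectorField.lieBracket_const_smul_right hz.differentiableAt, VectorField.lieBracket_self]
    simp
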